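/- Let $A,B$ be finite-dimensional complex Hilbert spaces, let $\{Z_A^j\}_j$ be a finite family of mutually orthogonal projectors on $A$ with $\sum_j Z_A^j=\mathbb 1$ (also written $Z_A^j$ for $Z_A^j\otimes\mathbb 1_B$), let $\Gamma_1,\dots,\Gamma_{m}$ be Hermitian operators on $AB$ and $\gamma_i^{LB},\gamma_i^{UB}\in\mathbb R$. Let $$\mathcal C=\{\rho_{AB}\succeq 0:\ \mathrm{Tr}\,\rho_{AB}=1,\ \gamma_i^{LB}\le \mathrm{Tr}(\rho_{AB}\Gamma_i)\le\gamma_i^{UB}\ \text{for all } i\},$$ and assume $\mathcal C\neq\emptyset$. Write $F(\rho,\sigma)=\big(\mathrm{Tr}\sqrt{\sqrt\rho\,\sigma\sqrt\rho}\big)^2$, and $H_{\min}(X|Y)_\rho=\max_{\sigma_Y}\max\{h\in\mathbb R:\rho_{XY}\preceq 2^{-h}\,\mathbb 1_X\otimes\sigma_Y\}$, with $\sigma_Y$ ranging over density operators. For a purification $|\psi\rangle_{ABE}$ of a density operator $\rho_{AB}$ ($E$ finite-dimensional), $H_{\min}(Z_A|E)$ is the conditional min-entropy of the reduced state on $Z_AE$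 of $V|\psi\rangle$, where $V=\sum_j|j\rangle_{Z_A}\otimes Z_A^j$. 1. For every density operator $\rho_{AB}$ and every purification of it, all maxima below are attained and $$H_{\min}(Z_A|E)=-\log_2\max_{\sigma_{AB}}F\Big(\rho_{AB},\sum_j Z_A^j\sigma_{AB}Z_A^j\Big),$$ the maximum being over density operators $\sigma_{AB}$. 2. The minimum $g=\min_{\rho_{AB}\in\mathcal C}H_{\min}(Z_A|E)$ exists (over states in $\mathcal C$ and their purifications, for any $E$ with $\dim E\ge\dim A\cdot\dim B$; it does not depend on $E$), the following maximum is attained, and $$g=-2\log_2\max_{\rho_{AB}\in\mathcal C}\max_{\sigma_{AB}}\sqrt{F\Big(\rho_{AB},\sum_jZ_A^j\sigma_{AB}Z_A^j\Big)},$$ i.e. $2^{-g/2}$ equals this maximum. 3. $2^{-g/2}$ is the (attained) optimal value of the SDP: maximize $\frac12(\mathrm{Tr}X_{12}+\mathrm{Tr}X_{12}^\dagger)$ subject to $X_{11}\preceq\rho_{AB}$, $X_{22}\preceq\sum_jZ_A^j\sigma_{AB}Z_A^j$, $\gamma_i^{LB}\le\mathrm{Tr}(\rho_{AB}\Gamma_i)\le\gamma_i^{UB}$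 for all $i$, $\mathrm{Tr}\rho_{AB}=\mathrm{Tr}\sigma_{AB}=1$, $\begin{pmatrix}X_{11}&X_{12}\\X_{12}^\dagger&X_{22}\end{pmatrix}\succeq0$, $\rho_{AB}\succeq0$, $\sigma_{AB}\succeq0$. 4. Let $(z,\bar y,x,y,Y_{11},Y_{22})$, with $z,\bar y\in\mathbb R$ and $x,y\in\mathbb R^m$, be any feasible point of the dual SDP: minimize $z+\bar y+\sum_i(y_i\gamma_i^{UB}-x_i\gamma_i^{LB})$ subject to $\sum_i(y_i-x_i)\Gamma_i+\bar y\,\mathbb 1\succeq Y_{11}$, $z\,\mathbb 1\succeq\sum_jZ_A^jY_{22}Z_A^j$, $\begin{pmatrix}Y_{11}&0\\0&Y_{22}\end{pmatrix}\succeq\frac12\begin{pmatrix}0&\mathbb 1\\\mathbb 1&0\end{pmatrix}$, $Y_{11}\succeq0$, $Y_{22}\succeq0$, $x_i,y_i\ge0$. Let $v$ be its objective value. Then $2^{-g/2}\le v$ and $-2\log_2v\le g$; consequently $-2\log_2 v\le H_{\min}(Z_A|E)$ for every $\rho_{AB}\in\mathcal C$ and every purification of it. Moreover, for integers $0<n\le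 N$, $\mathrm{leak}_{EC}\in\mathbb R$ and $\varepsilon_{PA},\varepsilon_{cor}>0$, the key rate $$r(h)=\frac nN\Big\lfloor h-\frac1n\mathrm{leak}_{EC}-\frac2n\log_2\frac1{2\varepsilon_{PA}}-\frac1n\log_2\frac2{\varepsilon_{cor}}\Big\rfloor$$ satisfies $r(-2\log_2v)\le r(H_{\min}(Z_A|E))$. -/

import Mathlib

open scoped Matrix Kronecker ComplexOrder MatrixOrder

noncomputable section

namespace QKD

/-- Normalized density operators on the finite-dimensional space `ℂ^X`. -/
def IsDensity {X : Type*} [Fintype X] (ρ : Matrix X X ℂ) : Prop :=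
  ρ.PosSemidef ∧ ρ.trace = 1

/-- The fidelity `F(ρ, σ) = (Tr √(√ρ σ √ρ))²` of positive semidefinite operators. -/
def fidelity {X : Type*} [Fintype X] [DecidableEq X] (ρ σ : Matrix X X ℂ) : ℝ :=
  ((CFC.sqrt (CFC.sqrt ρ * σ * CFC.sqrt ρ)).trace.re) ^ 2

/-- The real numbers `h` with `ρ_XY ≤ 2^{-h} (1_X ⊗ σ_Y)` for some density operator `σ_Y`. -/
def minEntropyWitnesses {X Y : Type*} [Fintype X] [DecidableEq X] [Fintype Y]
    (ρ : Matrix (X × Y) (X × Y) ℂ) : Set ℝ :=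
  {h | ∃ σ : Matrix Y Y ℂ, IsDensity σ ∧
    ρ ≤ ((2 : ℝ) ^ (-h)) • ((1 : Matrix X X ℂ) ⊗ₖ σ)}

/-- The conditional min-entropy (in bits, optimized over the state of the conditioning system)
`H_min(X|Y)_ρ = max_σ sup {h | ρ_XY ≤ 2^{-h} (1_X ⊗ σ_Y)}`. -/
def condMinEntropy {X Y : Type*} [Fintype X] [DecidableEq X] [Fintype Y]
    (ρ : Matrix (X × Y) (X × Y) ℂ) : ℝ :=
  sSup (minEntropyWitnesses ρ)

/-- A projective measurement: orthogonal projectors `Z^j` with `∑_j Z^j = 1`. -/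
structure IsProjectiveMeasurement {A J : Type*} [Fintype A] [DecidableEq A] [Fintype J]
    (Z : J → Matrix A A ℂ) : Prop where
  isStarProjection : ∀ j, IsStarProjection (Z j)
  mul_eq_zero : ∀ i j, i ≠ j → Z i * Z j = 0
  sum_eq_one : ∑ j, Z j = 1

/-- The operator `Z_A^j`, acting on the joint system `AB`. -/
def onAB {A J : Type*} (B : Type*) [DecidableEq B] (Z : J → Matrix A A ℂ) (j : J) :
    Matrix (A × B) (A × B) ℂ :=
  Z j ⊗ₖ (1 : Matrix B B ℂ)

/-- The map `M ↦ ∑_j Z_A^j M Z_A^j` on operators on `AB`. -/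
def pinch {A B J : Type*} [Fintype A] [Fintype B] [DecidableEq B] [Fintype J]
    (Z : J → Matrix A A ℂ) (M : Matrix (A × B) (A × B) ℂ) : Matrix (A × B) (A × B) ℂ :=
  ∑ j, onAB B Z j * M * onAB B Z j

/-- The key-map isometry `V = ∑_j |j⟩ ⊗ Z_A^j` from `AB` to `Z_A AB`. -/
def keyIsometry {A J : Type*} (B : Type*) [DecidableEq B] (Z : J → Matrix A A ℂ) :
    Matrix (J × (A × B)) (A × B) ℂ :=
  Matrix.of fun p x => onAB B Z p.1 p.2 x

/-- The rank-one operator `|ψ⟩⟨ψ|`. -/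
def pureState {X : Type*} (ψ : X → ℂ) : Matrix X X ℂ :=
  Matrix.vecMulVec ψ (star ψ)

/-- The partial trace over the second factor. -/
def traceRight {X Y : Type*} [Fintype Y] (M : Matrix (X × Y) (X × Y) ℂ) : Matrix X X ℂ :=
  Matrix.of fun x x' => ∑ y, M (x, y) (x', y)

/-- The partial trace over the middle factor. -/
def traceMiddle {W X Y : Type*} [Fintype X] (M : Matrix ((W × X) × Y) ((W × X) × Y) ℂ) :
    Matrix (W × Y) (W × Y) ℂ :=
  Matrix.of fun p q => ∑ x, M ((p.1, x), p.2) ((q.1, x), q.2)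

/-- The vector `ψ` of the system `X E` purifies the state `ρ_X`. -/
def IsPurification {X E : Type*} [Fintype E] (ψ : X × E → ℂ) (ρ : Matrix X X ℂ) : Prop :=
  traceRight (pureState ψ) = ρ

/-- The state of `Z_A E`: apply the key-map isometry to the pure state `|ψ⟩⟨ψ|` of `ABE`
and trace out `AB`. -/
def keyEveState {A B J E : Type*} [Fintype A] [Fintype B] [DecidableEq B]
    [Fintype E] [DecidableEq E] (Z : J → Matrix A A ℂ) (ψ : (A × B) × E → ℂ) :
    Matrix (J × E) (J × E) ℂ :=
  traceMiddle ((keyIsometry B Z ⊗ₖ (1 : Matrix E E ℂ)) * pureState ψ *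
    (keyIsometry B Z ⊗ₖ (1 : Matrix E E ℂ))ᴴ)

/-- `H_min(Z_A|E)` for the pure state `ψ` of `ABE`. -/
def keyMinEntropy {A B J E : Type*} [Fintype A] [Fintype B] [DecidableEq B]
    [Fintype J] [DecidableEq J] [Fintype E] [DecidableEq E]
    (Z : J → Matrix A A ℂ) (ψ : (A × B) × E → ℂ) : ℝ :=
  condMinEntropy (keyEveState Z ψ)

/-- The set of density operators `ρ` with `γLB_i ≤ Tr(ρ Γ_i) ≤ γUB_i` for all `i`. -/
def constraintSet {X ι : Type*} [Fintype X] (Γ : ι → Matrix X X ℂ) (γLB γUB : ι → ℝ) :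
    Set (Matrix X X ℂ) :=
  {ρ | IsDensity ρ ∧ ∀ i, γLB i ≤ (ρ * Γ i).trace.re ∧ (ρ * Γ i).trace.re ≤ γUB i}

/-- All values of `H_min(Z_A|E)` for states `ρ_AB` in `C` purified by the system `E`. -/
def keyMinEntropyValues {A B J : Type*} [Fintype A] [Fintype B] [DecidableEq B]
    [Fintype J] [DecidableEq J] (E : Type*) [Fintype E] [DecidableEq E]
    (Z : J → Matrix A A ℂ) (C : Set (Matrix (A × B) (A × B) ℂ)) : Set ℝ :=
  {h | ∃ ρ ∈ C, ∃ ψ : (A × B) × E → ℂ, IsPurification ψ ρ ∧ h = keyMinEntropy Z ψ}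

/-- Feasible points of the primal semidefinite program. -/
structure PrimalFeasible {A B J ι : Type*} [Fintype A] [Fintype B]
    [DecidableEq B] [Fintype J]
    (Z : J → Matrix A A ℂ) (Γ : ι → Matrix (A × B) (A × B) ℂ) (γLB γUB : ι → ℝ)
    (ρ σ X₁₁ X₁₂ X₂₂ : Matrix (A × B) (A × B) ℂ) : Prop where
  le_rho : X₁₁ ≤ ρ
  le_pinch : X₂₂ ≤ pinch Z σ
  upper : ∀ i, (ρ * Γ i).trace.re ≤ γUB i
  lower : ∀ i, γLB i ≤ (ρ * Γ i).trace.re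
  trace_rho : ρ.trace = 1
  trace_sigma : σ.trace = 1
  block : 0 ≤ Matrix.fromBlocks X₁₁ X₁₂ X₁₂ᴴ X₂₂
  rho_nonneg : 0 ≤ ρ
  sigma_nonneg : 0 ≤ σ

/-- The primal objective `(Tr X₁₂ + Tr X₁₂†) / 2`. -/
def primalObjective {X : Type*} [Fintype X] (X₁₂ : Matrix X X ℂ) : ℝ :=
  ((1 / 2 : ℂ) * (X₁₂.trace + X₁₂ᴴ.trace)).re

/-- Feasible points of the dual semidefinite program. -/
structure DualFeasible {A B J ι : Type*} [Fintype A] [DecidableEq A] [Fintype B]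
    [DecidableEq B] [Fintype J] [Fintype ι]
    (Z : J → Matrix A A ℂ) (Γ : ι → Matrix (A × B) (A × B) ℂ)
    (z ybar : ℝ) (x y : ι → ℝ) (Y₁₁ Y₂₂ : Matrix (A × B) (A × B) ℂ) : Prop where
  le_sum : Y₁₁ ≤ ∑ i, (y i - x i) • Γ i + ybar • (1 : Matrix (A × B) (A × B) ℂ)
  pinch_le : pinch Z Y₂₂ ≤ z • (1 : Matrix (A × B) (A × B) ℂ)
  block : (1 / 2 : ℝ) • Matrix.fromBlocks 0 1 1 0 ≤ Matrix.fromBlocks Y₁₁ 0 0 Y₂₂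
  Y₁₁_nonneg : 0 ≤ Y₁₁
  Y₂₂_nonneg : 0 ≤ Y₂₂
  y_nonneg : ∀ i, 0 ≤ y i
  x_nonneg : ∀ i, 0 ≤ x i

/-- The dual objective `z + ȳ + ∑_i (y_i γUB_i - x_i γLB_i)`. -/
def dualObjective {ι : Type*} [Fintype ι] (γLB γUB : ι → ℝ) (z ybar : ℝ) (x y : ι → ℝ) : ℝ :=
  z + ybar + ∑ i, (y i * γUB i - x i * γLB i)

/-- The min-entropy secret key rate per transmission as a function of the min-entropy `h`,
for `N` transmitted signals of which `n` are used for the key, error-correction leakage `leak`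
(in bits), and privacy-amplification and correctness parameters `εPA`, `εcor`. -/
def keyRate (n N : ℕ) (leak εPA εcor h : ℝ) : ℝ :=
  (n / N : ℝ) * (⌊h - 1 / n * leak - 2 / n * Real.logb 2 (1 / (2 * εPA))
    - 1 / n * Real.logb 2 (2 / εcor)⌋ : ℤ)

end QKD

end

/-! Write a purification as a matrix `K` with `ρ = K Kᴴ`, and let `P j` be the key projectors on
`AB`. The key–Eve state is block diagonal with blocks `(Kᴴ P_j K)ᵀ`, so `2^{-H_min}` is the least
`l` for which one density operator `τ` satisfies `Kᴴ P_j K ≤ l τ` for all `j`. By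
`exists_guessing_dual` this equals Eve's optimal guessing probability `p`; its proof perturbs an
optimal measurement and needs no general conic duality.

The root fidelity is the largest `Re Tr X` over positive blocks `[[ρ, X], [Xᴴ, ω]]`
(`isGreatest_rootFidelity`). An optimal measurement turns into a pinched state of fidelity at least
`p` (`exists_block_of_measurement`). Conversely, `W = K τ⁻¹ Kᴴ`, regularised, is a dual certificate
bounding every pinched fidelity by `l` (`re_trace_le_sqrt`). These bounds meet in
`exists_optimal_pinched_fidelity`, the single-state formula.

Minimising entropy over the constraint set thus means maximising root fidelity over `ρ` and `σ`. The
block form makes this a linear maximisation over a compact set, so the maximum is attained and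
equals the primal value. The dual bound uses only weak duality, the pinching being self-adjoint for
the trace pairing. -/

namespace QKD

open Matrix

/-! ### Positive matrices: trace inequalities, Schur complements, compactness -/

section PositiveMatrices

variable {m n : Type*} [Fintype m] [Fintype n]

lemma exists_eq_conjTranspose_mul_self {P : Matrix n n ℂ} (hP : P.PosSemidef) :
    ∃ G : Matrix n n ℂ, P = Gᴴ * G := by
  classical
  exact CStarAlgebra.nonneg_iff_eq_star_mul_self.mp hP.nonneg

lemma trace_re_nonneg {P : Matrix n n ℂ} (hP : P.PosSemidef) : 0 ≤ P.trace.re :=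
  (Complex.nonneg_iff.mp hP.trace_nonneg).1

lemma trace_mul_re_nonneg {P Q : Matrix n n ℂ} (hP : P.PosSemidef) (hQ : Q.PosSemidef) :
    0 ≤ (P * Q).trace.re := by
  obtain ⟨G, rfl⟩ := exists_eq_conjTranspose_mul_self hP
  rw [Matrix.mul_assoc, Matrix.trace_mul_comm]
  exact trace_re_nonneg (hQ.mul_mul_conjTranspose_same G)

lemma trace_mul_re_mono {P Q R : Matrix n n ℂ} (hP : P.PosSemidef) (h : Q ≤ R) :
    (P * Q).trace.re ≤ (P * R).trace.re := by
  have := trace_mul_re_nonneg hP (Matrix.le_iff.mp h)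
  rw [Matrix.mul_sub, Matrix.trace_sub, Complex.sub_re] at this
  linarith

lemma trace_re_mono {Q R : Matrix n n ℂ} (h : Q ≤ R) : Q.trace.re ≤ R.trace.re := by
  have := trace_re_nonneg (Matrix.le_iff.mp h)
  rw [Matrix.trace_sub, Complex.sub_re] at this
  linarith

lemma trace_eq_ofReal {P : Matrix n n ℂ} (hP : P.PosSemidef) : P.trace = (P.trace.re : ℂ) := by
  have := (Complex.nonneg_iff.mp hP.trace_nonneg).2
  apply Complex.ext <;> simp [← this]

lemma trace_fromBlocks (M : Matrix m m ℂ) (N : Matrix m n ℂ) (N' : Matrix n m ℂ)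
    (P : Matrix n n ℂ) : (fromBlocks M N N' P).trace = M.trace + P.trace := by
  simp [Matrix.trace]

/-- The pairing of a positive block matrix with a feasible point of the fidelity program. -/
lemma re_trace_le_of_block [DecidableEq n] {ρ ω X Y₁ Y₂ : Matrix n n ℂ}
    (h : (fromBlocks ρ X Xᴴ ω).PosSemidef)
    (hY : (1 / 2 : ℝ) • fromBlocks 0 1 1 0 ≤ fromBlocks Y₁ 0 0 Y₂) :
    X.trace.re ≤ (ρ * Y₁).trace.re + (ω * Y₂).trace.re := by
  have := trace_mul_re_mono h hY
  simp only [fromBlocks_smul, fromBlocks_multiply, trace_fromBlocks, Matrix.mul_zero,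
    Matrix.mul_one, smul_zero, Matrix.mul_smul, zero_add, add_zero, Matrix.trace_smul,
    Matrix.trace_conjTranspose, Complex.add_re, Complex.smul_re] at this
  simp only [Complex.star_def, Complex.conj_re, smul_eq_mul] at this
  linarith

/-- The Schur complement of the difference is exactly zero. The free scale `s` later balances the
two terms of the fidelity bound. -/
lemma half_offDiag_le [DecidableEq n] {Y : Matrix n n ℂ} (hY : Y.PosDef) {s : ℝ} (hs : 0 < s) :
    (1 / 2 : ℝ) • fromBlocks 0 1 1 0 ≤
      fromBlocks ((s / 2) • Y⁻¹) 0 0 ((s⁻¹ / 2) • Y) := by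
  have hD : ((s⁻¹ / 2) • Y).PosDef := hY.smul (by positivity)
  let := hD.isUnit.invertible
  rw [Matrix.le_iff]
  have key := (Matrix.PosDef.fromBlocks₂₂ ((s / 2) • Y⁻¹) ((-(1 / 2) : ℝ) • (1 : Matrix n n ℂ))
    hD).mpr ?_
  · have e : fromBlocks ((s / 2) • Y⁻¹) 0 0 ((s⁻¹ / 2) • Y) - (1 / 2 : ℝ) • fromBlocks 0 1 1 0 =
        fromBlocks ((s / 2) • Y⁻¹) ((-(1 / 2) : ℝ) • (1 : Matrix n n ℂ))
          ((-(1 / 2) : ℝ) • (1 : Matrix n n ℂ))ᴴ ((s⁻¹ / 2) • Y) := by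
      rw [conjTranspose_smul, conjTranspose_one, fromBlocks_smul]
      ext (i | i) (j | j) <;> simp
    rw [e]
    exact key
  · have hinv : ((s⁻¹ / 2) • Y)⁻¹ = (2 * s) • Y⁻¹ := by
      apply Matrix.inv_eq_left_inv
      have : Y⁻¹ * Y = 1 := Matrix.nonsing_inv_mul _ ((Matrix.isUnit_iff_isUnit_det _).mp hY.isUnit)
      rw [Matrix.smul_mul, Matrix.mul_smul, this, smul_smul]
      have : 2 * s * (s⁻¹ / 2) = 1 := by field_simp
      rw [this, one_smul]
    rw [hinv]
    convert Matrix.PosSemidef.zero using 1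
    rw [conjTranspose_smul, conjTranspose_one]
    simp only [Matrix.smul_mul, Matrix.mul_smul, Matrix.one_mul, Matrix.mul_one, smul_smul]
    rw [← sub_smul]
    convert zero_smul ℝ _ using 2
    simp; ring

lemma isClosed_posSemidef : IsClosed {M : Matrix n n ℂ | M.PosSemidef} := by
  simp only [posSemidef_iff_dotProduct_mulVec, Set.ofPred_and, Set.ofPred_forall]
  refine IsClosed.inter (isClosed_eq (by fun_prop) continuous_id) (isClosed_iInter fun x => ?_)
  exact isClosed_le continuous_const (by fun_prop)

/-- The minor on rows `i, j` gives `|M i j|² ≤ M i i * M j j`, and each diagonal entry is at most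
the trace. -/
lemma norm_apply_le_trace {M : Matrix n n ℂ} (hM : M.PosSemidef) (i j : n) :
    ‖M i j‖ ≤ M.trace.re := by
  classical
  have hd : ∀ k, 0 ≤ (M k k).re := fun k => (Complex.nonneg_iff.mp hM.diag_nonneg).1
  have hi : ∀ k, (M k k).im = 0 := fun k => ((Complex.nonneg_iff.mp hM.diag_nonneg).2).symm
  have ht : ∀ k, (M k k).re ≤ M.trace.re := fun k => by
    rw [Matrix.trace, Complex.re_sum]
    exact Finset.single_le_sum (f := fun k => (M k k).re) (fun k _ => hd k) (Finset.mem_univ k)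
  have hdet := (hM.submatrix ![i, j]).det_nonneg
  rw [Matrix.det_fin_two] at hdet
  simp only [Matrix.submatrix_apply, Matrix.cons_val_zero, Matrix.cons_val_one] at hdet
  rw [← hM.isHermitian.apply j i] at hdet
  have h2 := (Complex.nonneg_iff.mp hdet).1
  rw [Complex.star_def, Complex.mul_conj, Complex.sub_re, Complex.mul_re, hi i, Complex.ofReal_re,
    Complex.normSq_eq_norm_sq] at h2
  have h3 := mul_le_mul (ht i) (ht j) (hd j) ((hd i).trans (ht i))
  refine le_of_sq_le_sq ?_ ((hd i).trans (ht i)) 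
  nlinarith

lemma isCompact_posSemidef_trace_le (c : ℝ) :
    IsCompact {M : Matrix n n ℂ | M.PosSemidef ∧ M.trace.re ≤ c} := by
  have hK : IsCompact (X := Matrix n n ℂ)
      (Set.univ.pi fun _ => Set.univ.pi fun _ => Metric.closedBall (0 : ℂ) c) :=
    isCompact_univ_pi (X := fun _ : n => n → ℂ) fun _ =>
      isCompact_univ_pi fun _ => isCompact_closedBall _ _
  refine hK.of_isClosed_subset ?_ ?_
  · rw [Set.ofPred_and]
    exact isClosed_posSemidef.inter (isClosed_le (by fun_prop) continuous_const)
  · rintro M ⟨hM, hc⟩ i - j -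
    simpa using (norm_apply_le_trace hM i j).trans hc

end PositiveMatrices

/-! ### Polar decomposition and the semidefinite form of the root fidelity -/

section Fidelity

variable {m n : Type*} [Fintype m] [Fintype n] [DecidableEq n]

lemma posSemidef_sqrt (P : Matrix n n ℂ) : (CFC.sqrt P).PosSemidef :=
  (CFC.sqrt_nonneg P).posSemidef

lemma isHermitian_sqrt (P : Matrix n n ℂ) : (CFC.sqrt P)ᴴ = CFC.sqrt P :=
  (posSemidef_sqrt P).isHermitian

lemma sqrt_mul_sqrt {P : Matrix n n ℂ} (hP : P.PosSemidef) : CFC.sqrt P * CFC.sqrt P = P :=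
  CFC.sqrt_mul_sqrt_self P hP.nonneg

/-- A Hermitian matrix has a commuting Hermitian generalized inverse. -/
lemma exists_pseudoinverse {S : Matrix n n ℂ} (hS : S.IsHermitian) :
    ∃ T : Matrix n n ℂ, Tᴴ = T ∧ T * S = S * T ∧ S * T * S = S := by
  have hsa : IsSelfAdjoint S := hS
  have hc : ∀ f : ℝ → ℝ, ContinuousOn f (spectrum ℝ S) := fun f =>
    S.finite_real_spectrum.continuousOn f
  -- Since `0⁻¹ = 0`, this inverts `S` on its range and vanishes on its kernel; `x * x⁻¹ * x = x`
  -- holds even at zero.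
  refine ⟨cfc (fun x : ℝ => x⁻¹) S, cfc_predicate (p := IsSelfAdjoint) _ S, ?_, ?_⟩
  · have h1 : cfc (fun x : ℝ => x⁻¹) S * S = cfc (fun x : ℝ => x⁻¹ * x) S := by
      rw [cfc_mul (fun x : ℝ => x⁻¹) (fun x => x) S (hc _) (hc _), cfc_id' ℝ S]
    have h2 : S * cfc (fun x : ℝ => x⁻¹) S = cfc (fun x : ℝ => x * x⁻¹) S := by
      rw [cfc_mul (fun x : ℝ => x) (fun x => x⁻¹) S (hc _) (hc _), cfc_id' ℝ S]
    rw [h1, h2]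
    simp only [mul_comm]
  · have h1 : S * cfc (fun x : ℝ => x⁻¹) S = cfc (fun x : ℝ => x * x⁻¹) S := by
      rw [cfc_mul (fun x : ℝ => x) (fun x => x⁻¹) S (hc _) (hc _), cfc_id' ℝ S]
    have h2 : S * cfc (fun x : ℝ => x⁻¹) S * S = cfc (fun x : ℝ => x * x⁻¹ * x) S := by
      rw [h1, cfc_mul (fun x : ℝ => x * x⁻¹) (fun x => x) S (hc _) (hc _), cfc_id' ℝ S]
    rw [h2]
    simp only [mul_inv_mul_cancel]
    exact cfc_id' ℝ S

/-- Polar decomposition with a contraction. -/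
lemma exists_polar (M : Matrix m n ℂ) :
    ∃ U : Matrix m n ℂ, Uᴴ * U ≤ 1 ∧ U * CFC.sqrt (Mᴴ * M) = M ∧
      Uᴴ * M = CFC.sqrt (Mᴴ * M) := by
  set S := CFC.sqrt (Mᴴ * M) with hSdef
  have hSS : S * S = Mᴴ * M := sqrt_mul_sqrt (posSemidef_conjTranspose_mul_self M)
  have hSh : Sᴴ = S := isHermitian_sqrt _
  obtain ⟨T, hT, hc, hSTS⟩ := exists_pseudoinverse hSh
  have hE : (S * T) * (S * T) = S * T := by rw [← Matrix.mul_assoc, hSTS]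
  have hEh : (S * T)ᴴ = S * T := by rw [conjTranspose_mul, hT, hSh, hc]
  -- The Gram matrix of `M * T` is the orthogonal projection `S * T` onto the range of `S`.
  refine ⟨M * T, ?_, ?_, ?_⟩
  · have e : (M * T)ᴴ * (M * T) = S * T := by
      rw [conjTranspose_mul, hT, Matrix.mul_assoc, ← Matrix.mul_assoc Mᴴ, ← hSS,
        Matrix.mul_assoc S, ← Matrix.mul_assoc T, hc, hE]
    rw [e, Matrix.le_iff]
    have : (1 - S * T) = (1 - S * T)ᴴ * (1 - S * T) := by
      rw [conjTranspose_sub, hEh, conjTranspose_one, Matrix.mul_sub, Matrix.sub_mul, Matrix.sub_mul,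
        hE]
      simp
    rw [this]
    exact posSemidef_conjTranspose_mul_self _
  -- `M` and `S` have the same kernel, so `M` is unchanged by this projection: the difference has
  -- zero Gram matrix.
  · have h0 : (M - M * (S * T))ᴴ * (M - M * (S * T)) = 0 := by
      rw [conjTranspose_sub, conjTranspose_mul, hEh, Matrix.sub_mul, Matrix.mul_sub, Matrix.mul_sub]
      have e₁ : Mᴴ * (M * (S * T)) = S * S := by
        rw [← Matrix.mul_assoc, ← hSS, Matrix.mul_assoc, ← hc, ← Matrix.mul_assoc S T S, hSTS]
      have e₂ : S * T * Mᴴ * M = S * S := by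
        rw [Matrix.mul_assoc _ Mᴴ, ← hSS, ← Matrix.mul_assoc, hSTS]
      have e₃ : S * T * Mᴴ * (M * (S * T)) = S * S := by
        rw [Matrix.mul_assoc _ Mᴴ, e₁, ← Matrix.mul_assoc, hSTS]
      rw [e₁, e₂, e₃, hSS]
      simp
    rw [Matrix.mul_assoc, hc]
    exact (sub_eq_zero.mp (conjTranspose_mul_self_eq_zero.mp h0)).symm
  · rw [conjTranspose_mul, hT, Matrix.mul_assoc, ← hSS, ← Matrix.mul_assoc, hc, hSTS]

/-- The block `[[1, Uᴴ], [U, 1]]` is positive for a contraction; conjugate it by `diag(√ρ, √ω)`. -/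
lemma posSemidef_fromBlocks_of_factor {ρ ω : Matrix n n ℂ} (hρ : ρ.PosSemidef)
    (hω : ω.PosSemidef) {U : Matrix n n ℂ} (hU : Uᴴ * U ≤ 1) :
    (fromBlocks ρ (CFC.sqrt ρ * Uᴴ * CFC.sqrt ω) (CFC.sqrt ρ * Uᴴ * CFC.sqrt ω)ᴴ ω).PosSemidef := by
  have h1 : (fromBlocks 1 Uᴴ U (1 : Matrix n n ℂ)).PosSemidef := by
    let := invertibleOne (α := Matrix n n ℂ)
    have := (Matrix.PosDef.fromBlocks₂₂ (1 : Matrix n n ℂ) Uᴴ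
      (Matrix.PosDef.one : (1 : Matrix n n ℂ).PosDef)).mpr
      (by simpa using Matrix.le_iff.mp hU)
    simpa using this
  have := h1.mul_mul_conjTranspose_same (fromBlocks (CFC.sqrt ρ) 0 0 (CFC.sqrt ω))
  simpa [fromBlocks_conjTranspose, fromBlocks_multiply, isHermitian_sqrt, sqrt_mul_sqrt hρ,
    sqrt_mul_sqrt hω, conjTranspose_mul, Matrix.mul_assoc] using this

lemma trace_contraction_mul_le {l : Type*} [Fintype l] {V : Matrix m n ℂ} (hV : Vᴴ * V ≤ 1)
    (W : Matrix n l ℂ) : ((V * W)ᴴ * (V * W)).trace.re ≤ (Wᴴ * W).trace.re := by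
  have := trace_re_nonneg ((Matrix.le_iff.mp hV).conjTranspose_mul_mul_same W)
  rw [Matrix.mul_sub, Matrix.sub_mul, Matrix.mul_one, Matrix.trace_sub, Complex.sub_re] at this
  rw [conjTranspose_mul]
  simp only [Matrix.mul_assoc] at this ⊢
  linarith

omit [DecidableEq n] in
lemma re_trace_mul_le {P Q : Matrix m n ℂ} :
    2 * (Pᴴ * Q).trace.re ≤ (Pᴴ * P).trace.re + (Qᴴ * Q).trace.re := by
  have h := trace_re_nonneg (posSemidef_conjTranspose_mul_self (P - Q))
  have e : (Qᴴ * P).trace.re = (Pᴴ * Q).trace.re := by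
    rw [← Complex.conj_re, ← Complex.star_def, ← Matrix.trace_conjTranspose]
    simp
  rw [conjTranspose_sub, Matrix.sub_mul, Matrix.mul_sub, Matrix.mul_sub] at h
  simp only [Matrix.trace_sub, Complex.sub_re, e] at h
  linarith

/-- The root fidelity `Tr √(√ρ ω √ρ)` is the value of a semidefinite program. -/
theorem isGreatest_rootFidelity {ρ ω : Matrix n n ℂ} (hρ : ρ.PosSemidef) (hω : ω.PosSemidef) :
    IsGreatest {f | ∃ X, (fromBlocks ρ X Xᴴ ω).PosSemidef ∧ f = X.trace.re}
      (√(fidelity ρ ω)) := by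
  obtain ⟨M, hM⟩ : ∃ M, M = CFC.sqrt ω * CFC.sqrt ρ := ⟨_, rfl⟩
  have hMM : Mᴴ * M = CFC.sqrt ρ * ω * CFC.sqrt ρ := by
    rw [hM, conjTranspose_mul, isHermitian_sqrt, isHermitian_sqrt, Matrix.mul_assoc,
      ← Matrix.mul_assoc (CFC.sqrt ω), sqrt_mul_sqrt hω, Matrix.mul_assoc]
  have hfid : √(fidelity ρ ω) = (CFC.sqrt (Mᴴ * M)).trace.re := by
    rw [fidelity, ← hMM, Real.sqrt_sq (trace_re_nonneg (posSemidef_sqrt _))]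
  obtain ⟨U, hU, hUS, hUM⟩ := exists_polar M
  rw [hfid]
  refine ⟨⟨_, posSemidef_fromBlocks_of_factor hρ hω hU, ?_⟩, ?_⟩
  · rw [← hUM, hM, Matrix.mul_assoc (CFC.sqrt ρ), Matrix.trace_mul_comm (CFC.sqrt ρ),
      Matrix.mul_assoc]
  · rintro _ ⟨X, hX, rfl⟩
    -- The two column halves of a Gram factor have polar forms `V₁ √ρ` and `V₂ √ω`, so `X = √ρ V₁ᴴ
    -- V₂ √ω`. Then `Tr X = Tr (V₁ᴴ V₂ U S)`; splitting `S = R R` leaves an arithmetic–geometric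
    -- mean bound.
    obtain ⟨G, hG⟩ := exists_eq_conjTranspose_mul_self hX
    obtain ⟨g₁, hg₁⟩ : ∃ g : Matrix (n ⊕ n) n ℂ, g = G.submatrix id Sum.inl := ⟨_, rfl⟩
    obtain ⟨g₂, hg₂⟩ : ∃ g : Matrix (n ⊕ n) n ℂ, g = G.submatrix id Sum.inr := ⟨_, rfl⟩
    have e₁ : g₁ᴴ * g₁ = ρ := by
      ext i j
      rw [hg₁]
      exact (congrFun₂ hG (Sum.inl i) (Sum.inl j)).symm
    have e₂ : g₂ᴴ * g₂ = ω := by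
      ext i j
      rw [hg₂]
      exact (congrFun₂ hG (Sum.inr i) (Sum.inr j)).symm
    have e₃ : g₁ᴴ * g₂ = X := by
      ext i j
      rw [hg₁, hg₂]
      exact (congrFun₂ hG (Sum.inl i) (Sum.inr j)).symm
    obtain ⟨V₁, hV₁, h₁, -⟩ := exists_polar g₁
    obtain ⟨V₂, hV₂, h₂, -⟩ := exists_polar g₂
    rw [e₁] at h₁
    rw [e₂] at h₂
    generalize hS : CFC.sqrt (Mᴴ * M) = S at *
    have hSps : S.PosSemidef := hS ▸ posSemidef_sqrt _
    obtain ⟨R, hR⟩ : ∃ R, R = CFC.sqrt S := ⟨_, rfl⟩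
    have hRR : R * R = S := hR ▸ sqrt_mul_sqrt hSps
    have hRh : Rᴴ = R := hR ▸ isHermitian_sqrt S
    have key := re_trace_mul_le (P := V₁ * R) (Q := V₂ * U * R)
    have k₀ : ((V₁ * R)ᴴ * (V₂ * U * R)).trace = X.trace := by
      rw [← e₃, ← h₁, ← h₂]
      simp only [conjTranspose_mul, isHermitian_sqrt, hRh]
      calc (R * V₁ᴴ * (V₂ * U * R)).trace = (V₁ᴴ * V₂ * (U * (R * R))).trace := by
            rw [Matrix.mul_assoc, Matrix.trace_mul_comm]; simp only [Matrix.mul_assoc]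
        _ = (CFC.sqrt ρ * V₁ᴴ * (V₂ * CFC.sqrt ω)).trace := by
            rw [hRR, hUS, hM, Matrix.mul_assoc (CFC.sqrt ρ), Matrix.trace_mul_comm (CFC.sqrt ρ)]
            simp only [Matrix.mul_assoc]
    have k₁ := trace_contraction_mul_le hV₁ R
    have k₂ := (trace_contraction_mul_le hV₂ (U * R)).trans (trace_contraction_mul_le hU R)
    rw [← Matrix.mul_assoc V₂] at k₂
    rw [hRh, hRR] at k₁ k₂
    rw [k₀] at key
    linarith

end Fidelity

/-! ### Strong duality for the guessing probability -/

section GuessingProbability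

variable {J E : Type*} [Fintype J] [Fintype E] [DecidableEq E]

/-- A maximizer of the guessing probability over all measurements. -/
lemma exists_optimal_measurement [Nonempty J] (T : J → Matrix E E ℂ) :
    ∃ M : J → Matrix E E ℂ, (∀ j, (M j).PosSemidef) ∧ ∑ j, M j = 1 ∧
      ∀ N : J → Matrix E E ℂ, (∀ j, (N j).PosSemidef) → ∑ j, N j = 1 →
        ∑ j, (T j * N j).trace.re ≤ ∑ j, (T j * M j).trace.re := by
  classical
  let s : Set (J → Matrix E E ℂ) := {M | (∀ j, (M j).PosSemidef) ∧ ∑ j, M j = 1}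
  have hs : IsCompact s := by
    have hK : IsCompact (Set.univ.pi fun _ : J =>
        {M : Matrix E E ℂ | M.PosSemidef ∧ M.trace.re ≤ Fintype.card E}) :=
      isCompact_univ_pi fun _ => isCompact_posSemidef_trace_le _
    refine hK.of_isClosed_subset ?_ ?_
    · simp only [s, Set.ofPred_and, Set.ofPred_forall]
      refine (isClosed_iInter fun j => ?_).inter (isClosed_eq (by fun_prop) continuous_const)
      exact isClosed_posSemidef.preimage
        (f := fun M : J → Matrix E E ℂ => M j) (continuous_apply j)
    · rintro M ⟨hM, h1⟩ j -
      refine ⟨hM j, ?_⟩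
      have hle : M j ≤ 1 := by
        rw [← h1]
        exact Finset.single_le_sum (fun i _ => (hM i).nonneg) (Finset.mem_univ j)
      simpa using trace_re_mono hle
  have hne : s.Nonempty := by
    refine ⟨Pi.single (Classical.arbitrary J) 1, fun j => ?_, by simp⟩
    by_cases h : j = Classical.arbitrary J
    · rw [h, Pi.single_eq_same]; exact PosSemidef.one
    · rw [Pi.single_eq_of_ne h]; exact PosSemidef.zero
  obtain ⟨M, hM, hmax⟩ := hs.exists_isMaxOn hne
    (f := fun M => ∑ j, (T j * M j).trace.re) (by fun_prop)
  exact ⟨M, hM.1, hM.2, fun N hN h1 => hmax (show N ∈ s from ⟨hN, h1⟩)⟩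

omit [DecidableEq E] in
lemma trace_mul_vecMulVec (M : Matrix E E ℂ) (v : E → ℂ) :
    (M * vecMulVec v (star v)).trace = star v ⬝ᵥ (M *ᵥ v) := by
  rw [Matrix.mul_vecMulVec, Matrix.trace_vecMulVec, dotProduct_comm]

/-- A quadratic bound on a right neighbourhood of zero bounds the linear coefficient. -/
lemma nonpos_of_quadratic_bound {a b c : ℝ} (hc : 0 < c)
    (h : ∀ s, 0 < s → s ≤ c → s * a + s ^ 2 * b ≤ 0) : a ≤ 0 := by
  have ht : Filter.Tendsto (fun s : ℝ => a + s * b) (nhdsWithin 0 (Set.Ioi 0)) (nhds a) := by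
    have : Continuous fun s : ℝ => a + s * b := by fun_prop
    simpa using (this.tendsto 0).mono_left nhdsWithin_le_nhds
  refine le_of_tendsto ht ?_
  filter_upwards [Ioc_mem_nhdsGT hc] with s hs
  have := h s hs.1 hs.2
  by_contra hneg
  push Not at hneg
  nlinarith [mul_pos hs.1 hneg]

/-- Strong duality for the guessing probability: an optimal measurement yields an operator
dominating all `T j` whose trace is the optimal value. -/
theorem exists_guessing_dual [Nonempty J] {T : J → Matrix E E ℂ} (hT : ∀ j, (T j).PosSemidef) :
    ∃ (M : J → Matrix E E ℂ) (τ : Matrix E E ℂ), (∀ j, (M j).PosSemidef) ∧ ∑ j, M j = 1 ∧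
      (∀ j, T j ≤ τ) ∧ τ.trace = ∑ j, (T j * M j).trace := by
  classical
  obtain ⟨M, hM, h1, hmax⟩ := exists_optimal_measurement T
  -- The Hermitian part of `∑ T_j M_j`; symmetrising makes `τ` Hermitian without first using
  -- optimality.
  let τ : Matrix E E ℂ := (1 / 2 : ℝ) • ∑ j, (T j * M j + M j * T j)
  refine ⟨M, τ, hM, h1, fun k => ?_, ?_⟩
  · rw [Matrix.le_iff]
    have hH : (τ - T k).IsHermitian := by
      refine IsHermitian.sub ?_ (hT k).isHermitian
      simp only [τ, IsHermitian, conjTranspose_smul, conjTranspose_sum, conjTranspose_add,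
        conjTranspose_mul, (hT _).isHermitian.eq, (hM _).isHermitian.eq, star_trivial]
      simp only [add_comm]
    refine PosSemidef.of_dotProduct_mulVec_nonneg hH fun v => ?_
    rw [Complex.nonneg_iff]
    refine ⟨?_, (hH.im_star_dotProduct_mulVec_self v).symm⟩
    rw [← trace_mul_vecMulVec]
    obtain ⟨P, hPdef⟩ : ∃ P, P = vecMulVec v (star v) := ⟨_, rfl⟩
    rw [← hPdef]
    have hP : P.PosSemidef := hPdef ▸ posSemidef_vecMulVec_self_star v
    obtain ⟨c, hc0, hc⟩ : ∃ c : ℝ, 0 ≤ c ∧ P * P = c • P := by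
      have h0 : 0 ≤ star v ⬝ᵥ v := dotProduct_star_self_nonneg v
      refine ⟨(star v ⬝ᵥ v).re, (Complex.nonneg_iff.mp h0).1, ?_⟩
      have : star v ⬝ᵥ v = ((star v ⬝ᵥ v).re : ℂ) := by
        apply Complex.ext <;> simp [← (Complex.nonneg_iff.mp h0).2]
      rw [hPdef, vecMulVec_mul_vecMulVec, this]
      ext i j
      simp [vecMulVec_apply]
      ring
    have hτ : (τ * P).trace.re = 1 / 2 *
        ∑ j, ((T j * M j * P).trace.re + (T j * P * M j).trace.re) := by
      simp only [τ, Matrix.smul_mul, Matrix.trace_smul, Complex.smul_re, Matrix.sum_mul,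
        Matrix.add_mul, Matrix.trace_sum, Matrix.trace_add, Complex.re_sum, Complex.add_re,
        smul_eq_mul]
      congr 1
      refine Finset.sum_congr rfl fun j _ => ?_
      rw [Matrix.mul_assoc (M j), Matrix.trace_mul_comm (M j)]
    -- Perturb the optimal measurement: conjugate by `Q = 1 - s P` and give the lost weight `1 - Q²
    -- = (2s - s²c) P` to outcome `k`. The cutoff on `s` keeps this weight nonnegative. The
    -- first-order term yields `Tr (T_k P) ≤ Tr (τ P)`.
    have hbound : ∀ s : ℝ, 0 < s → s ≤ 2 / (c + 1) →
        s * (2 * (T k * P).trace.re - 2 * (τ * P).trace.re) +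
          s ^ 2 * (∑ j, (T j * (P * M j * P)).trace.re - c * (T k * P).trace.re) ≤ 0 := by
      intro s hs hsc
      have hsc' : 0 ≤ 2 * s - s ^ 2 * c := by
        rw [le_div_iff₀ (by positivity)] at hsc
        nlinarith
      let Q : Matrix E E ℂ := 1 - s • P
      have hQ : Qᴴ = Q := by simp [Q, hP.isHermitian.eq]
      have hexp : ∀ N : Matrix E E ℂ,
          Q * N * Q = N - s • (N * P) - s • (P * N) + s ^ 2 • (P * N * P) := by
        intro N
        simp only [Q, Matrix.mul_sub, Matrix.sub_mul, Matrix.mul_one, Matrix.one_mul,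
          Matrix.smul_mul, Matrix.mul_smul]
        module
      have hN := hmax (fun j => Q * M j * Q + if j = k then (2 * s - s ^ 2 * c) • P else 0) ?_ ?_
      · simp only [Matrix.mul_add, Matrix.trace_add, Complex.add_re, Finset.sum_add_distrib,
          mul_ite, Matrix.mul_zero] at hN
        have e₁ : ∑ j, (T j * (Q * M j * Q)).trace.re = ∑ j, (T j * M j).trace.re
            - 2 * s * (τ * P).trace.re + s ^ 2 * ∑ j, (T j * (P * M j * P)).trace.re := by
          rw [hτ]
          simp only [hexp, Matrix.mul_add, Matrix.mul_sub, Matrix.mul_smul, Matrix.trace_add,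
            Matrix.trace_sub, Matrix.trace_smul, Complex.add_re, Complex.sub_re, Complex.smul_re,
            smul_eq_mul, Finset.sum_add_distrib, Finset.sum_sub_distrib, ← Finset.mul_sum,
            ← Matrix.mul_assoc]
          ring
        have e₂ : ∑ j, (if j = k then T j * ((2 * s - s ^ 2 * c) • P) else 0).trace.re =
            (2 * s - s ^ 2 * c) * (T k * P).trace.re := by
          rw [Finset.sum_eq_single k]
          · rw [if_pos rfl, Matrix.mul_smul, Matrix.trace_smul, Complex.smul_re, smul_eq_mul]
          · intro j _ hj; simp [hj]
          · simp
        rw [e₁, e₂] at hN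
        linarith
      · intro j
        refine PosSemidef.add ?_ ?_
        · simpa [hQ] using (hM j).conjTranspose_mul_mul_same Q
        · split_ifs
          · exact hP.smul hsc'
          · exact PosSemidef.zero
      · rw [Finset.sum_add_distrib, ← Finset.sum_mul, ← Finset.mul_sum, h1, hexp]
        simp only [Finset.sum_ite_eq', Finset.mem_univ, if_true, Matrix.one_mul, Matrix.mul_one, hc,
          smul_smul]
        module
    have := nonpos_of_quadratic_bound (by positivity) hbound
    rw [Matrix.sub_mul, Matrix.trace_sub, Complex.sub_re]
    linarith
  · have e : ∀ j, (M j * T j).trace = (T j * M j).trace := fun j => Matrix.trace_mul_comm _ _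
    simp only [τ, Matrix.trace_smul, Matrix.trace_sum, Matrix.trace_add, e, ← two_mul,
      ← Finset.mul_sum]
    rw [Complex.real_smul]
    push_cast
    ring

end GuessingProbability

/-! ### Pinching, and both directions between domination and fidelity -/

section Pinching

variable {X E J : Type*} [Fintype X] [DecidableEq X] [Fintype E] [DecidableEq E] [Fintype J]
  {P : J → Matrix X X ℂ}

lemma IsProjectiveMeasurement.mul_self (hP : IsProjectiveMeasurement P) (j : J) :
    P j * P j = P j :=
  (hP.isStarProjection j).isIdempotentElem

lemma IsProjectiveMeasurement.conjTranspose (hP : IsProjectiveMeasurement P) (j : J) :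
    (P j)ᴴ = P j :=
  (hP.isStarProjection j).isSelfAdjoint

lemma IsProjectiveMeasurement.posSemidef_conj (hP : IsProjectiveMeasurement P) (j : J)
    {M : Matrix X X ℂ} (hM : M.PosSemidef) : (P j * M * P j).PosSemidef := by
  simpa [hP.conjTranspose] using hM.conjTranspose_mul_mul_same (P j)

lemma IsProjectiveMeasurement.posSemidef_sum_conj (hP : IsProjectiveMeasurement P)
    {M : Matrix X X ℂ} (hM : M.PosSemidef) : (∑ j, P j * M * P j).PosSemidef :=
  posSemidef_sum _ fun j _ => hP.posSemidef_conj j hM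

omit [DecidableEq X] in
lemma trace_sum_conj_mul (M N : Matrix X X ℂ) :
    ((∑ j, P j * M * P j) * N).trace = (M * ∑ j, P j * N * P j).trace := by
  simp only [Matrix.sum_mul, Matrix.mul_sum, Matrix.trace_sum]
  refine Finset.sum_congr rfl fun j _ => ?_
  rw [Matrix.mul_assoc, Matrix.mul_assoc, Matrix.trace_mul_comm]
  simp only [Matrix.mul_assoc]

lemma IsProjectiveMeasurement.sum_conj_one (hP : IsProjectiveMeasurement P) :
    ∑ j, P j * 1 * P j = 1 := by
  simp [hP.mul_self, hP.sum_eq_one]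

lemma IsProjectiveMeasurement.trace_sum_conj (hP : IsProjectiveMeasurement P)
    (M : Matrix X X ℂ) : (∑ j, P j * M * P j).trace = M.trace := by
  have := trace_sum_conj_mul (P := P) M 1
  rwa [hP.sum_conj_one, Matrix.mul_one, Matrix.mul_one] at this

omit [Fintype X] [DecidableEq X] in
lemma fromBlocks_sum {ι : Type*} (s : Finset ι) (a b c d : ι → Matrix X X ℂ) :
    ∑ i ∈ s, fromBlocks (a i) (b i) (c i) (d i) =
      fromBlocks (∑ i ∈ s, a i) (∑ i ∈ s, b i) (∑ i ∈ s, c i) (∑ i ∈ s, d i) := by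
  ext (i | i) (j | j) <;> simp [Matrix.sum_apply]

/-- A measurement on `E` with guessing probability `p` gives a state whose pinching has root
fidelity at least `√p` with `K Kᴴ`. -/
lemma exists_block_of_measurement (hP : IsProjectiveMeasurement P) (K : Matrix X E ℂ)
    {M : J → Matrix E E ℂ} (hM : ∀ j, (M j).PosSemidef) (h1 : ∑ j, M j = 1) {p : ℝ} (hp : 0 < p)
    (hval : ∑ j, (Kᴴ * P j * K * M j).trace = p) :
    ∃ σ Y : Matrix X X ℂ, IsDensity σ ∧
      (fromBlocks (K * Kᴴ) Y Yᴴ (∑ j, P j * σ * P j)).PosSemidef ∧ Y.trace.re = √p := by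
  have hsq : 0 < √p := Real.sqrt_pos.mpr hp
  let N : J → Matrix X X ℂ := fun j => K * M j * Kᴴ
  have hN : ∀ j, (N j).PosSemidef := fun j => (hM j).mul_mul_conjTranspose_same K
  have htr : ∑ j, (N j * P j).trace = p := by
    rw [← hval]
    refine Finset.sum_congr rfl fun j _ => ?_
    simp only [N, Matrix.mul_assoc]
    rw [Matrix.trace_mul_comm]
    simp only [Matrix.mul_assoc]
    rw [Matrix.trace_mul_comm]
    simp only [Matrix.mul_assoc]
  -- The normalised post-measurement state is already block diagonal, hence fixed by the pinching.
  let σ : Matrix X X ℂ := p⁻¹ • ∑ j, P j * N j * P j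
  have hpinch : ∑ j, P j * σ * P j = σ := by
    simp only [σ, Matrix.mul_smul, Matrix.smul_mul, Matrix.mul_sum, Matrix.sum_mul,
      ← Finset.smul_sum]
    congr 1
    refine Finset.sum_congr rfl fun j _ => ?_
    rw [Finset.sum_eq_single j]
    · simp only [Matrix.mul_assoc, hP.mul_self]
      rw [← Matrix.mul_assoc (P j) (P j), hP.mul_self]
    · intro i _ hi
      simp only [← Matrix.mul_assoc, hP.mul_eq_zero j i hi.symm, Matrix.zero_mul]
    · simp
  refine ⟨σ, (√p)⁻¹ • ∑ j, N j * P j, ⟨?_, ?_⟩, ?_, ?_⟩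
  · exact (posSemidef_sum _ fun j _ => hP.posSemidef_conj j (hN j)).smul (by positivity)
  · have e : ∀ j, (P j * N j * P j).trace = (N j * P j).trace := fun j => by
      rw [Matrix.mul_assoc, Matrix.trace_mul_comm, Matrix.mul_assoc, hP.mul_self]
    simp only [σ, Matrix.trace_smul, Matrix.trace_sum, e, htr]
    rw [Complex.real_smul, ← Complex.ofReal_mul, inv_mul_cancel₀ hp.ne', Complex.ofReal_one]
  · rw [hpinch]
    -- Each summand is `N j` conjugated by the column `(1, p^{-1/2} P_j)`; since the `M j` sum to
    -- `1`, the upper left blocks add up to `K Kᴴ`.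
    have hsum : (∑ j, fromBlocks (N j) ((√p)⁻¹ • (N j * P j)) ((√p)⁻¹ • (P j * N j))
        (p⁻¹ • (P j * N j * P j))).PosSemidef := by
      refine posSemidef_sum _ fun j _ => ?_
      have := (hN j).mul_mul_conjTranspose_same
        (Matrix.fromRows (1 : Matrix X X ℂ) ((√p)⁻¹ • P j))
      have hpp : (√p)⁻¹ * (√p)⁻¹ = p⁻¹ := by
        rw [← mul_inv, Real.mul_self_sqrt hp.le]
      rw [conjTranspose_fromRows_eq_fromCols_conjTranspose, fromRows_mul,
        fromRows_mul_fromCols] at this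
      simpa [hP.conjTranspose, smul_smul, hpp] using this
    rw [fromBlocks_sum] at hsum
    have e₁ : ∑ j, N j = K * Kᴴ := by
      simp only [N]
      rw [← Matrix.sum_mul, ← Matrix.mul_sum, h1, Matrix.mul_one]
    have e₂ : ((√p)⁻¹ • ∑ j, N j * P j)ᴴ = ∑ j, (√p)⁻¹ • (P j * N j) := by
      simp only [conjTranspose_smul, conjTranspose_sum, conjTranspose_mul, hP.conjTranspose,
        (hN _).isHermitian.eq, star_trivial, Finset.smul_sum]
    rw [e₂, ← e₁, Finset.smul_sum]
    simpa only [σ, Finset.smul_sum] using hsum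
  · rw [Matrix.trace_smul, Matrix.trace_sum, htr, Complex.real_smul, ← Complex.ofReal_mul,
      Complex.ofReal_re, inv_mul_eq_div, Real.div_sqrt]

/-- If `Kᴴ P_j K ≤ l τ` for all `j`, then `P` pinches `K τ⁻¹ Kᴴ` below `l`. -/
lemma sum_conj_le_of_le (hP : IsProjectiveMeasurement P) (K : Matrix X E ℂ) {τ : Matrix E E ℂ}
    (hτ : τ.PosDef) {l : ℝ} (hl : 0 < l) (h : ∀ j, Kᴴ * P j * K ≤ l • τ) :
    ∑ j, P j * (K * τ⁻¹ * Kᴴ) * P j ≤ l • (1 : Matrix X X ℂ) := by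
  have hlτ : (l • τ).PosDef := hτ.smul hl
  let := hlτ.isUnit.invertible
  let := invertibleOne (α := Matrix X X ℂ)
  have hinv : (l • τ)⁻¹ = l⁻¹ • τ⁻¹ := by
    apply Matrix.inv_eq_left_inv
    have : τ⁻¹ * τ = 1 := Matrix.nonsing_inv_mul _ ((Matrix.isUnit_iff_isUnit_det _).mp hτ.isUnit)
    rw [Matrix.smul_mul, Matrix.mul_smul, this, smul_smul, inv_mul_cancel₀ hl.ne', one_smul]
  have hj : ∀ j, (l • P j - P j * (K * τ⁻¹ * Kᴴ) * P j).PosSemidef := by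
    intro j
    -- One block matrix, two Schur complements: one is the hypothesis, the other gives the bound on
    -- `P_j K τ⁻¹ Kᴴ P_j` after compression by `P j`.
    have hb : (fromBlocks (l • τ) (Kᴴ * P j) (Kᴴ * P j)ᴴ (1 : Matrix X X ℂ)).PosSemidef := by
      rw [Matrix.PosDef.fromBlocks₂₂ _ _ PosDef.one]
      have := Matrix.le_iff.mp (h j)
      simpa [conjTranspose_mul, hP.conjTranspose, Matrix.mul_assoc, ← Matrix.mul_assoc (P j) (P j),
        hP.mul_self] using this
    rw [Matrix.PosDef.fromBlocks₁₁ _ _ hlτ, hinv] at hb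
    have := (hP.posSemidef_conj j hb).smul hl.le
    convert this using 1
    simp only [conjTranspose_mul, conjTranspose_conjTranspose, hP.conjTranspose, Matrix.mul_sub,
      Matrix.sub_mul, Matrix.mul_one, hP.mul_self, Matrix.smul_mul, Matrix.mul_smul, smul_sub,
      smul_smul, mul_inv_cancel₀ hl.ne', one_smul]
    congr 1
    simp only [Matrix.mul_assoc, hP.mul_self]
    simp only [← Matrix.mul_assoc, hP.mul_self]
  rw [Matrix.le_iff, ← hP.sum_eq_one, Finset.smul_sum, ← Finset.sum_sub_distrib]
  exact posSemidef_sum _ fun j _ => hj j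

/-- Weak duality between the min-entropy program and the root fidelity program. -/
theorem re_trace_le_sqrt (hP : IsProjectiveMeasurement P) {K : Matrix X E ℂ} {τ : Matrix E E ℂ}
    (hτ : IsDensity τ) {l : ℝ} (hl : 0 < l) (h : ∀ j, Kᴴ * P j * K ≤ l • τ)
    {σ Y : Matrix X X ℂ} (hσ : IsDensity σ)
    (hY : (fromBlocks (K * Kᴴ) Y Yᴴ (∑ j, P j * σ * P j)).PosSemidef) : Y.trace.re ≤ √l := by
  have hsl : 0 < √l := Real.sqrt_pos.mpr hl
  -- Neither `τ` nor `K τ⁻¹ Kᴴ` need be invertible, so both are shifted by `ε`; the limit `ε → 0`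
  -- gives `√l / 2 + l / (2√l) = √l`.
  have hbound : ∀ ε : ℝ, 0 < ε → Y.trace.re ≤
      √l / 2 * (1 + ε * Fintype.card E) + (√l)⁻¹ / 2 * (l + ε) := by
    intro ε hε
    have hτ' : (τ + ε • (1 : Matrix E E ℂ)).PosDef :=
      PosDef.posSemidef_add hτ.1 (PosDef.one.smul hε)
    obtain ⟨τ', hτ'def⟩ : ∃ τ', τ' = τ + ε • (1 : Matrix E E ℂ) := ⟨_, rfl⟩
    rw [← hτ'def] at hτ'
    have h' : ∀ j, Kᴴ * P j * K ≤ l • τ' := fun j => by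
      refine (h j).trans ?_
      rw [Matrix.le_iff, hτ'def, smul_add, add_sub_cancel_left]
      exact (PosSemidef.one.smul hε.le).smul hl.le
    have hpin := sum_conj_le_of_le hP K hτ' hl h'
    let W : Matrix X X ℂ := K * τ'⁻¹ * Kᴴ + ε • 1
    have hW : W.PosDef := PosDef.posSemidef_add
      (hτ'.posSemidef.inv.mul_mul_conjTranspose_same K) (PosDef.one.smul hε)
    let := hτ'.isUnit.invertible
    let := hW.isUnit.invertible
    -- Taking the Schur complement on the other side turns `K τ'⁻¹ Kᴴ ≤ W` into this, which bounds
    -- `Tr (ρ W⁻¹)` by `Tr τ'`.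
    have hsch : Kᴴ * W⁻¹ * K ≤ τ' := by
      have hb : (fromBlocks τ' Kᴴ Kᴴᴴ W).PosSemidef := by
        rw [Matrix.PosDef.fromBlocks₁₁ _ _ hτ']
        simp only [W, conjTranspose_conjTranspose, add_sub_cancel_left]
        exact PosSemidef.one.smul hε.le
      rw [Matrix.PosDef.fromBlocks₂₂ _ _ hW] at hb
      simpa [Matrix.le_iff] using hb
    have h₁ : (K * Kᴴ * W⁻¹).trace.re ≤ 1 + ε * Fintype.card E := by
      have e : (K * Kᴴ * W⁻¹).trace = (Kᴴ * W⁻¹ * K).trace := by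
        rw [Matrix.mul_assoc, Matrix.trace_mul_comm]
      rw [e]
      refine (trace_re_mono hsch).trans (le_of_eq ?_)
      simp [hτ'def, hτ.2]
    have h₂ : ((∑ j, P j * σ * P j) * W).trace.re ≤ l + ε := by
      rw [trace_sum_conj_mul]
      have hle : ∑ j, P j * W * P j ≤ (l + ε) • (1 : Matrix X X ℂ) := by
        have e : ∑ j, P j * W * P j =
            ∑ j, P j * (K * τ'⁻¹ * Kᴴ) * P j + ε • (1 : Matrix X X ℂ) := by
          simp only [W, Matrix.mul_add, Matrix.add_mul, Finset.sum_add_distrib, Matrix.mul_smul,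
            Matrix.smul_mul, ← Finset.smul_sum, hP.sum_conj_one]
        rw [e, add_smul]
        exact add_le_add_left hpin _
      refine (trace_mul_re_mono hσ.1 hle).trans (le_of_eq ?_)
      simp [hσ.2]
    refine (re_trace_le_of_block hY (half_offDiag_le hW hsl)).trans ?_
    simp only [Matrix.mul_smul, Matrix.trace_smul, Complex.smul_re, smul_eq_mul]
    gcongr
  have ht : Filter.Tendsto (fun ε : ℝ => √l / 2 * (1 + ε * Fintype.card E) +
      (√l)⁻¹ / 2 * (l + ε)) (nhdsWithin 0 (Set.Ioi 0)) (nhds (√l)) := by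
    have hc : Continuous fun ε : ℝ => √l / 2 * (1 + ε * Fintype.card E) +
      (√l)⁻¹ / 2 * (l + ε) := by fun_prop
    have := (hc.tendsto 0).mono_left (nhdsWithin_le_nhds (s := Set.Ioi 0))
    convert this using 2
    field_simp
    rw [Real.sq_sqrt hl.le]
    ring
  refine ge_of_tendsto ht ?_
  filter_upwards [self_mem_nhdsWithin] with ε hε using hbound ε hε

end Pinching

/-! ### Equality of guessing probability and maximal pinched fidelity -/

section SingleState

variable {X E J : Type*} [Fintype X] [DecidableEq X] [Fintype E] [DecidableEq E] [Fintype J]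
  {P : J → Matrix X X ℂ}

lemma fidelity_nonneg (ρ σ : Matrix X X ℂ) : 0 ≤ fidelity ρ σ := sq_nonneg _

/-- Strong duality between the min-entropy program and the fidelity program. -/
theorem exists_optimal_pinched_fidelity (hP : IsProjectiveMeasurement P) {K : Matrix X E ℂ}
    (hK : IsDensity (K * Kᴴ)) :
    ∃ p : ℝ, 0 < p ∧
      IsGreatest {f | ∃ σ, IsDensity σ ∧ f = fidelity (K * Kᴴ) (∑ j, P j * σ * P j)} p ∧
      (∃ τ, IsDensity τ ∧ ∀ j, Kᴴ * P j * K ≤ p • τ) ∧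
      ∀ l : ℝ, 0 < l → ∀ τ, IsDensity τ → (∀ j, Kᴴ * P j * K ≤ l • τ) → p ≤ l := by
  have hJ : Nonempty J := by
    by_contra hJ
    rw [not_nonempty_iff] at hJ
    have h01 : (0 : Matrix X X ℂ) = 1 := by simpa using hP.sum_eq_one
    have := hK.2
    rw [← Matrix.mul_one (K * Kᴴ), ← h01, Matrix.mul_zero, Matrix.trace_zero] at this
    exact zero_ne_one this
  have hT : ∀ j, (Kᴴ * P j * K).PosSemidef := fun j => by
    have h1 : (P j).PosSemidef := by
      simpa [hP.mul_self] using hP.posSemidef_conj j PosSemidef.one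
    exact h1.conjTranspose_mul_mul_same K
  obtain ⟨M, τ, hM, hM1, hle, htr⟩ := exists_guessing_dual hT
  have hτ : τ.PosSemidef :=
    ((hT (Classical.arbitrary J)).nonneg.trans (hle (Classical.arbitrary J))).posSemidef
  obtain ⟨p, hp⟩ : ∃ p : ℝ, τ.trace = (p : ℂ) := ⟨_, trace_eq_ofReal hτ⟩
  have hsum : ∑ j, (Kᴴ * P j * K).trace.re = 1 := by
    rw [← Complex.re_sum, ← Matrix.trace_sum, ← Matrix.sum_mul, ← Matrix.mul_sum, hP.sum_eq_one,
      Matrix.mul_one, Matrix.trace_mul_comm, hK.2, Complex.one_re]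
  have hp0 : 0 < p := by
    by_contra hneg
    have : ∑ j, (Kᴴ * P j * K).trace.re ≤ 0 := Finset.sum_nonpos fun j _ => by
      have := trace_re_mono (hle j)
      rw [hp, Complex.ofReal_re] at this
      linarith
    linarith
  have hdens : IsDensity (p⁻¹ • τ) := by
    refine ⟨hτ.smul (by positivity), ?_⟩
    rw [Matrix.trace_smul, hp, Complex.real_smul, ← Complex.ofReal_mul, inv_mul_cancel₀ hp0.ne',
      Complex.ofReal_one]
  have hdom : ∀ j, Kᴴ * P j * K ≤ p • p⁻¹ • τ := fun j => by
    rw [smul_smul, mul_inv_cancel₀ hp0.ne', one_smul]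
    exact hle j
  have hweak : ∀ l : ℝ, 0 < l → ∀ τ, IsDensity τ → (∀ j, Kᴴ * P j * K ≤ l • τ) →
      ∀ σ, IsDensity σ → fidelity (K * Kᴴ) (∑ j, P j * σ * P j) ≤ l := by
    intro l hl τ hτ h σ hσ
    obtain ⟨Y, hY, e⟩ := (isGreatest_rootFidelity hK.1 (hP.posSemidef_sum_conj hσ.1)).1
    have := re_trace_le_sqrt hP hτ hl h hσ hY
    rw [← e] at this
    exact (Real.sqrt_le_sqrt_iff hl.le).mp this
  -- The optimal measurement produces fidelity at least `p`, while `p⁻¹ • τ` with `l = p` caps every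
  -- fidelity at `p`.
  obtain ⟨σ, Y, hσ, hY, hYp⟩ := exists_block_of_measurement hP K hM hM1 hp0 (htr.symm.trans hp)
  have hge : p ≤ fidelity (K * Kᴴ) (∑ j, P j * σ * P j) := by
    have := (isGreatest_rootFidelity hK.1 (hP.posSemidef_sum_conj hσ.1)).2 ⟨Y, hY, rfl⟩
    rw [hYp] at this
    exact (Real.sqrt_le_sqrt_iff (fidelity_nonneg _ _)).mp this
  refine ⟨p, hp0, ⟨⟨σ, hσ, ?_⟩, ?_⟩, ⟨_, hdens, hdom⟩, fun l hl τ hτ h => ?_⟩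
  · exact le_antisymm hge (hweak p hp0 _ hdens hdom σ hσ)
  · rintro _ ⟨σ, hσ, rfl⟩
    exact hweak p hp0 _ hdens hdom σ hσ
  · exact hge.trans (hweak l hl τ hτ h σ hσ)

end SingleState

/-! ### From the key–Eve state to the dominated blocks -/

section KeyEntropy

/-- Blocks are principal submatrices; conversely the matrix is the sum of `|j⟩⟨j| ⊗ D j`. -/
lemma posSemidef_blockDiagonal_iff {J E : Type*} [Fintype J] [DecidableEq J] [Fintype E]
    {D : J → Matrix E E ℂ} :
    (Matrix.of fun p q : J × E => if p.1 = q.1 then D p.1 p.2 q.2 else 0).PosSemidef ↔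
      ∀ j, (D j).PosSemidef := by
  constructor
  · intro h j
    have := h.submatrix fun e => (j, e)
    convert this using 1
    ext e e'
    simp
  · intro h
    have : (∑ j, (Matrix.diagonal (Pi.single j (1 : ℂ))) ⊗ₖ D j).PosSemidef :=
      posSemidef_sum _ fun j _ => PosSemidef.kronecker
        (PosSemidef.diagonal (Pi.single_nonneg.mpr zero_le_one)) (h j)
    convert this using 1
    ext ⟨j, e⟩ ⟨j', e'⟩
    by_cases hj : j = j'
    · subst hj
      simp [Matrix.sum_apply, Matrix.kroneckerMap_apply, Pi.single_apply]
    · simp [Matrix.sum_apply, Matrix.kroneckerMap_apply, hj]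

variable {A B J : Type*} [Fintype A] [DecidableEq A] [Fintype B] [DecidableEq B]
  [Fintype J] {Z : J → Matrix A A ℂ}

lemma IsProjectiveMeasurement.onAB (hZ : IsProjectiveMeasurement Z) :
    IsProjectiveMeasurement (onAB B Z) where
  isStarProjection j := by
    refine ⟨?_, ?_⟩
    · rw [IsIdempotentElem, QKD.onAB, ← mul_kronecker_mul, hZ.mul_self, Matrix.mul_one]
    · rw [IsSelfAdjoint, star_eq_conjTranspose, QKD.onAB, conjTranspose_kronecker,
        hZ.conjTranspose, conjTranspose_one]
  mul_eq_zero i j hij := by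
    rw [QKD.onAB, QKD.onAB, ← mul_kronecker_mul, hZ.mul_eq_zero i j hij, zero_kronecker]
  sum_eq_one := by
    ext ⟨a, b⟩ ⟨a', b'⟩
    have := congrFun₂ hZ.sum_eq_one a a'
    simp only [Matrix.sum_apply, QKD.onAB, kroneckerMap_apply, ← Finset.sum_mul] at this ⊢
    rw [this]
    exact congrFun₂ (one_kronecker_one (α := ℂ)) (a, b) (a', b')

/-- The coefficient matrix of a vector of a bipartite system. -/
def coeffMatrix {X E : Type*} (ψ : X × E → ℂ) : Matrix X E ℂ := Matrix.of fun x e => ψ (x, e)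

lemma isPurification_iff {X E : Type*} [Fintype E] {ψ : X × E → ℂ} {ρ : Matrix X X ℂ} :
    IsPurification ψ ρ ↔ coeffMatrix ψ * (coeffMatrix ψ)ᴴ = ρ := by
  have : traceRight (pureState ψ) = coeffMatrix ψ * (coeffMatrix ψ)ᴴ := by
    ext x x'
    simp [traceRight, pureState, coeffMatrix, Matrix.mul_apply, vecMulVec_apply]
  rw [IsPurification, this]

variable {E : Type*} [Fintype E] [DecidableEq E] [DecidableEq J]

/-- The state of key and eavesdropper is block diagonal. -/
lemma keyEveState_eq (hZ : IsProjectiveMeasurement Z) (ψ : (A × B) × E → ℂ) :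
    keyEveState Z ψ = Matrix.of fun p q : J × E => if p.1 = q.1 then
      ((coeffMatrix ψ)ᴴ * onAB B Z p.1 * coeffMatrix ψ)ᵀ p.2 q.2 else 0 := by
  have hP := hZ.onAB (B := B)
  have hΦ : ∀ j x e, ((keyIsometry B Z ⊗ₖ (1 : Matrix E E ℂ)) *ᵥ ψ) ((j, x), e) =
      (onAB B Z j * coeffMatrix ψ) x e := by
    intro j x e
    simp [Matrix.mulVec, dotProduct, Fintype.sum_prod_type, keyIsometry, Matrix.mul_apply,
      coeffMatrix, Matrix.one_apply]
  ext ⟨j, e⟩ ⟨j', e'⟩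
  have h1 : keyEveState Z ψ (j, e) (j', e') =
      ((onAB B Z j' * coeffMatrix ψ)ᴴ * (onAB B Z j * coeffMatrix ψ)) e' e := by
    simp only [keyEveState, pureState, traceMiddle, Matrix.mul_vecMulVec, Matrix.vecMulVec_mul,
      ← Matrix.star_mulVec, Matrix.of_apply, vecMulVec_apply, hΦ, Pi.star_apply]
    rw [Matrix.mul_apply]
    exact Finset.sum_congr rfl fun x _ => by rw [conjTranspose_apply, mul_comm]
  rw [h1, conjTranspose_mul, hP.conjTranspose, Matrix.mul_assoc, ← Matrix.mul_assoc (onAB B Z j')]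
  by_cases hj : j = j'
  · subst hj
    simp [hP.mul_self, Matrix.mul_assoc]
  · simp [hP.mul_eq_zero j' j (Ne.symm hj), hj]

/-- Domination by `1 ⊗ σ` is tested block by block, and the transpose in the blocks is absorbed by
`τ = σᵀ`, again a density operator. -/
lemma mem_minEntropyWitnesses_iff (hZ : IsProjectiveMeasurement Z) (ψ : (A × B) × E → ℂ) (h : ℝ) :
    h ∈ minEntropyWitnesses (keyEveState Z ψ) ↔ ∃ τ, IsDensity τ ∧
      ∀ j, (coeffMatrix ψ)ᴴ * onAB B Z j * coeffMatrix ψ ≤ ((2 : ℝ) ^ (-h)) • τ := by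
  have key : ∀ σ : Matrix E E ℂ,
      keyEveState Z ψ ≤ ((2 : ℝ) ^ (-h)) • ((1 : Matrix J J ℂ) ⊗ₖ σ) ↔
      ∀ j, (coeffMatrix ψ)ᴴ * onAB B Z j * coeffMatrix ψ ≤ ((2 : ℝ) ^ (-h)) • σᵀ := by
    intro σ
    have e : ((2 : ℝ) ^ (-h)) • ((1 : Matrix J J ℂ) ⊗ₖ σ) - keyEveState Z ψ =
        Matrix.of fun p q : J × E => if p.1 = q.1 then
          (((2 : ℝ) ^ (-h)) • σᵀ - (coeffMatrix ψ)ᴴ * onAB B Z p.1 * coeffMatrix ψ)ᵀ p.2 q.2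
          else 0 := by
      rw [keyEveState_eq hZ]
      ext ⟨j, e⟩ ⟨j', e'⟩
      by_cases hj : j = j'
      · subst hj; simp
      · simp [hj]
    rw [Matrix.le_iff, e, posSemidef_blockDiagonal_iff
      (D := fun j => (((2 : ℝ) ^ (-h)) • σᵀ - (coeffMatrix ψ)ᴴ * onAB B Z j * coeffMatrix ψ)ᵀ)]
    simp only [posSemidef_transpose_iff, Matrix.le_iff]
  constructor
  · rintro ⟨σ, hσ, hle⟩
    exact ⟨σᵀ, ⟨hσ.1.transpose, by rw [Matrix.trace_transpose, hσ.2]⟩, (key σ).mp hle⟩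
  · rintro ⟨τ, hτ, hle⟩
    exact ⟨τᵀ, ⟨hτ.1.transpose, by rw [Matrix.trace_transpose, hτ.2]⟩, (key τᵀ).mpr
      (by simpa using hle)⟩

/-- The min-entropy of the key, given any purification, through the maximal fidelity. -/
theorem keyMinEntropy_eq (hZ : IsProjectiveMeasurement Z) {ρ : Matrix (A × B) (A × B) ℂ}
    {ψ : (A × B) × E → ℂ} (hρ : IsDensity ρ) (hψ : IsPurification ψ ρ) :
    IsGreatest (minEntropyWitnesses (keyEveState Z ψ)) (keyMinEntropy Z ψ) ∧
      ∃ m : ℝ, 0 < m ∧ IsGreatest {f | ∃ σ, IsDensity σ ∧ f = fidelity ρ (pinch Z σ)} m ∧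
        keyMinEntropy Z ψ = -Real.logb 2 m := by
  rw [isPurification_iff] at hψ
  subst hψ
  obtain ⟨p, hp, hgr, ⟨τ, hτ, hdom⟩, hmin⟩ :=
    exists_optimal_pinched_fidelity (hZ.onAB (B := B)) hρ
  have hG : IsGreatest (minEntropyWitnesses (keyEveState Z ψ)) (-Real.logb 2 p) := by
    constructor
    · rw [mem_minEntropyWitnesses_iff hZ]
      refine ⟨τ, hτ, ?_⟩
      rwa [neg_neg, Real.rpow_logb two_pos (by norm_num) hp]
    · intro h hh
      obtain ⟨τ, hτ, hle⟩ := (mem_minEntropyWitnesses_iff hZ ψ h).mp hh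
      have := hmin _ (Real.rpow_pos_of_pos two_pos _) τ hτ hle
      have := (Real.logb_le_iff_le_rpow one_lt_two hp).mpr this
      linarith
  have e : keyMinEntropy Z ψ = -Real.logb 2 p := hG.csSup_eq
  exact ⟨e ▸ hG, p, hp, hgr, e⟩

/-- Embed the basis of `X` into that of `E` by `W` with `W Wᴴ = 1`, and use `√ρ W` as coefficient
matrix. -/
lemma exists_purification {X E : Type*} [Fintype X] [DecidableEq X] [Fintype E] [DecidableEq E]
    (hcard : Fintype.card X ≤ Fintype.card E) {ρ : Matrix X X ℂ} (hρ : ρ.PosSemidef) :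
    ∃ ψ : X × E → ℂ, IsPurification ψ ρ := by
  obtain ⟨f⟩ := Function.Embedding.nonempty_of_card_le hcard
  let W : Matrix X E ℂ := Matrix.of fun x e => if f x = e then 1 else 0
  have hW : W * Wᴴ = 1 := by
    ext x x'
    simp [W, Matrix.mul_apply, Matrix.one_apply, apply_ite, f.injective.eq_iff, eq_comm]
  refine ⟨fun q => (CFC.sqrt ρ * W) q.1 q.2, isPurification_iff.mpr ?_⟩
  have : coeffMatrix (fun q : X × E => (CFC.sqrt ρ * W) q.1 q.2) = CFC.sqrt ρ * W := rfl
  rw [this, conjTranspose_mul, isHermitian_sqrt, Matrix.mul_assoc, ← Matrix.mul_assoc W, hW,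
    Matrix.one_mul, sqrt_mul_sqrt hρ]

end KeyEntropy

/-! ### Optimisation over the constraint set and the two programs -/

section Optimization

variable {A B J ι : Type*} [Fintype A] [DecidableEq A] [Fintype B] [DecidableEq B]
  [Fintype J] {Z : J → Matrix A A ℂ}
  {Γ : ι → Matrix (A × B) (A × B) ℂ} {γLB γUB : ι → ℝ}

lemma posSemidef_pinch (hZ : IsProjectiveMeasurement Z) {σ : Matrix (A × B) (A × B) ℂ}
    (hσ : σ.PosSemidef) : (pinch Z σ).PosSemidef :=
  (hZ.onAB (B := B)).posSemidef_sum_conj hσ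

lemma isClosed_constraintSet {X : Type*} [Fintype X] {Γ : ι → Matrix X X ℂ} {γLB γUB : ι → ℝ} :
    IsClosed (constraintSet Γ γLB γUB) := by
  simp only [constraintSet, IsDensity, Set.ofPred_and, Set.ofPred_forall]
  refine (isClosed_posSemidef.inter (isClosed_eq (by fun_prop) continuous_const)).inter
    (isClosed_iInter fun i => ?_)
  exact (isClosed_le continuous_const (by fun_prop)).inter
    (isClosed_le (by fun_prop) continuous_const)

/-- The root fidelity between a constrained state and a pinched state attains its maximum. -/
theorem exists_isGreatest_rootFidelity (hZ : IsProjectiveMeasurement Z)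
    (hC : (constraintSet Γ γLB γUB).Nonempty) :
    ∃ M : ℝ, IsGreatest {f | ∃ ρ ∈ constraintSet Γ γLB γUB, ∃ σ, IsDensity σ ∧
      f = √(fidelity ρ (pinch Z σ))} M := by
  -- Keeping the whole positive block as the variable makes the objective linear, so no continuity
  -- of the fidelity is needed. The block has trace `Tr ρ + Tr (pinch Z σ) = 2`.
  let S : Set (Matrix ((A × B) ⊕ (A × B)) ((A × B) ⊕ (A × B)) ℂ × Matrix (A × B) (A × B) ℂ) :=
    {q | q.1.PosSemidef ∧ q.1.toBlocks₁₁ ∈ constraintSet Γ γLB γUB ∧ IsDensity q.2 ∧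
      q.1.toBlocks₂₂ = pinch Z q.2}
  have hblock : ∀ ρ ∈ constraintSet Γ γLB γUB, ∀ σ, IsDensity σ →
      ∀ Y, (fromBlocks ρ Y Yᴴ (pinch Z σ)).PosSemidef →
      (fromBlocks ρ Y Yᴴ (pinch Z σ), σ) ∈ S := by
    intro ρ hρ σ hσ Y hY
    exact ⟨hY, by simpa using hρ, hσ, by simp⟩
  have hcomp : IsCompact S := by
    have hK := (isCompact_posSemidef_trace_le (n := (A × B) ⊕ (A × B)) 2).prod
      (isCompact_posSemidef_trace_le (n := A × B) 1)
    refine hK.of_isClosed_subset ?_ ?_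
    · simp only [S, IsDensity, Set.ofPred_and]
      have h11 : Continuous fun q : Matrix ((A × B) ⊕ (A × B)) ((A × B) ⊕ (A × B)) ℂ ×
          Matrix (A × B) (A × B) ℂ => q.1.toBlocks₁₁ :=
        continuous_matrix fun i j => continuous_fst.matrix_elem _ _
      have h22 : Continuous fun q : Matrix ((A × B) ⊕ (A × B)) ((A × B) ⊕ (A × B)) ℂ ×
          Matrix (A × B) (A × B) ℂ => q.1.toBlocks₂₂ :=
        continuous_matrix fun i j => continuous_fst.matrix_elem _ _
      refine (isClosed_posSemidef.preimage continuous_fst).inter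
        ((isClosed_constraintSet.preimage h11).inter
        (((isClosed_posSemidef.preimage continuous_snd).inter
          (isClosed_eq (by fun_prop) continuous_const)).inter (isClosed_eq h22 ?_)))
      unfold pinch
      fun_prop
    · rintro ⟨Q, σ⟩ ⟨hQ, h11, hσ, h22⟩
      refine ⟨⟨hQ, ?_⟩, hσ.1, by simp [hσ.2]⟩
      have htr : (pinch Z σ).trace = 1 := ((hZ.onAB (B := B)).trace_sum_conj σ).trans hσ.2
      rw [← fromBlocks_toBlocks Q, trace_fromBlocks]
      simp only at h11 h22
      rw [h11.1.2, h22, htr]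
      norm_num
  have hne : S.Nonempty := by
    obtain ⟨ρ, hρ⟩ := hC
    obtain ⟨Y, hY, -⟩ := (isGreatest_rootFidelity hρ.1.1 (posSemidef_pinch hZ hρ.1.1)).1
    exact ⟨_, hblock ρ hρ ρ hρ.1 Y hY⟩
  have hcont : Continuous fun q : Matrix ((A × B) ⊕ (A × B)) ((A × B) ⊕ (A × B)) ℂ ×
      Matrix (A × B) (A × B) ℂ => q.1.toBlocks₁₂.trace.re := by
    have h12 : Continuous fun q : Matrix ((A × B) ⊕ (A × B)) ((A × B) ⊕ (A × B)) ℂ ×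
        Matrix (A × B) (A × B) ℂ => q.1.toBlocks₁₂ :=
      continuous_matrix fun i j => continuous_fst.matrix_elem _ _
    exact Complex.continuous_re.comp h12.matrix_trace
  obtain ⟨⟨Q, σ⟩, ⟨hQ, hρ, hσ, h22⟩, hmax⟩ := hcomp.exists_isMaxOn hne hcont.continuousOn
  have hle : ∀ ρ ∈ constraintSet Γ γLB γUB, ∀ σ, IsDensity σ →
      √(fidelity ρ (pinch Z σ)) ≤ Q.toBlocks₁₂.trace.re := by
    intro ρ hρ σ hσ
    obtain ⟨Y, hY, e⟩ := (isGreatest_rootFidelity hρ.1.1 (posSemidef_pinch hZ hσ.1)).1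
    rw [e]
    simpa using hmax (hblock ρ hρ σ hσ Y hY)
  refine ⟨_, ⟨Q.toBlocks₁₁, hρ, σ, hσ, le_antisymm ?_ (hle _ hρ _ hσ)⟩, ?_⟩
  · refine (isGreatest_rootFidelity hρ.1.1 (posSemidef_pinch hZ hσ.1)).2 ⟨Q.toBlocks₁₂, ?_, rfl⟩
    have hH : Q.toBlocks₁₂ᴴ = Q.toBlocks₂₁ := by
      ext i j
      simpa [toBlocks₁₂, toBlocks₂₁] using hQ.isHermitian.apply (Sum.inr i) (Sum.inl j)
    simp only at h22 hQ
    rwa [hH, ← h22, fromBlocks_toBlocks]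
  · rintro _ ⟨ρ, hρ, σ, hσ, rfl⟩
    exact hle ρ hρ σ hσ

lemma primalObjective_eq {X : Type*} [Fintype X] (Y : Matrix X X ℂ) :
    primalObjective Y = Y.trace.re := by
  rw [primalObjective, Matrix.trace_conjTranspose, Complex.star_def, Complex.add_conj]
  simp

omit [DecidableEq A] in
lemma PrimalFeasible.mem_constraintSet {ρ σ X₁₁ X₁₂ X₂₂ : Matrix (A × B) (A × B) ℂ}
    (h : PrimalFeasible Z Γ γLB γUB ρ σ X₁₁ X₁₂ X₂₂) : ρ ∈ constraintSet Γ γLB γUB :=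
  ⟨⟨h.rho_nonneg.posSemidef, h.trace_rho⟩, fun i => ⟨h.lower i, h.upper i⟩⟩

omit [DecidableEq A] in
-- Adding the positive slacks to the diagonal preserves positivity, so relaxing the diagonal blocks
-- to inequalities gains nothing.
lemma PrimalFeasible.posSemidef_block {ρ σ X₁₁ X₁₂ X₂₂ : Matrix (A × B) (A × B) ℂ}
    (h : PrimalFeasible Z Γ γLB γUB ρ σ X₁₁ X₁₂ X₂₂) :
    (fromBlocks ρ X₁₂ X₁₂ᴴ (pinch Z σ)).PosSemidef := by
  have hd : (fromBlocks (ρ - X₁₁) 0 0 (pinch Z σ - X₂₂)).PosSemidef := by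
    obtain ⟨G, hG⟩ := exists_eq_conjTranspose_mul_self (Matrix.le_iff.mp h.le_rho)
    obtain ⟨H, hH⟩ := exists_eq_conjTranspose_mul_self (Matrix.le_iff.mp h.le_pinch)
    have := posSemidef_conjTranspose_mul_self (fromBlocks G 0 0 H)
    simpa [fromBlocks_conjTranspose, fromBlocks_multiply, ← hG, ← hH] using this
  have := hd.add h.block.posSemidef
  simpa [fromBlocks_add] using this

/-- The primal program attains the maximal root fidelity. -/
theorem isGreatest_primal (hZ : IsProjectiveMeasurement Z) {M : ℝ}
    (hM : IsGreatest {f | ∃ ρ ∈ constraintSet Γ γLB γUB, ∃ σ, IsDensity σ ∧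
      f = √(fidelity ρ (pinch Z σ))} M) :
    IsGreatest {f | ∃ ρ σ X₁₁ X₁₂ X₂₂, PrimalFeasible Z Γ γLB γUB ρ σ X₁₁ X₁₂ X₂₂ ∧
      f = primalObjective X₁₂} M := by
  constructor
  · obtain ⟨ρ, hρ, σ, hσ, rfl⟩ := hM.1
    obtain ⟨Y, hY, e⟩ := (isGreatest_rootFidelity hρ.1.1 (posSemidef_pinch hZ hσ.1)).1
    refine ⟨ρ, σ, ρ, Y, pinch Z σ, ⟨le_rfl, le_rfl, fun i => (hρ.2 i).2, fun i => (hρ.2 i).1,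
      hρ.1.2, hσ.2, hY.nonneg, hρ.1.1.nonneg, hσ.1.nonneg⟩, ?_⟩
    rw [primalObjective_eq, e]
  · rintro _ ⟨ρ, σ, X₁₁, X₁₂, X₂₂, h, rfl⟩
    have hσ : IsDensity σ := ⟨h.sigma_nonneg.posSemidef, h.trace_sigma⟩
    rw [primalObjective_eq]
    exact ((isGreatest_rootFidelity h.rho_nonneg.posSemidef (posSemidef_pinch hZ hσ.1)).2
      ⟨X₁₂, h.posSemidef_block, rfl⟩).trans
      (hM.2 ⟨ρ, h.mem_constraintSet, σ, hσ, rfl⟩)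

/-- Weak duality for the key-rate program. -/
theorem rootFidelity_le_dualObjective [Fintype ι] (hZ : IsProjectiveMeasurement Z)
    {z ybar : ℝ} {x y : ι → ℝ} {Y₁₁ Y₂₂ : Matrix (A × B) (A × B) ℂ}
    (hY : DualFeasible Z Γ z ybar x y Y₁₁ Y₂₂) {ρ σ : Matrix (A × B) (A × B) ℂ}
    (hρ : ρ ∈ constraintSet Γ γLB γUB) (hσ : IsDensity σ) :
    √(fidelity ρ (pinch Z σ)) ≤ dualObjective γLB γUB z ybar x y := by
  obtain ⟨Y, hblock, e⟩ := (isGreatest_rootFidelity hρ.1.1 (posSemidef_pinch hZ hσ.1)).1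
  have h₁ := trace_mul_re_mono hρ.1.1 hY.le_sum
  have h₂ := trace_mul_re_mono hσ.1 hY.pinch_le
  have h₃ : (pinch Z σ * Y₂₂).trace = (σ * pinch Z Y₂₂).trace := trace_sum_conj_mul σ Y₂₂
  have h₄ := re_trace_le_of_block hblock hY.block
  have e₁ : (ρ * (∑ i, (y i - x i) • Γ i + ybar • (1 : Matrix (A × B) (A × B) ℂ))).trace.re =
      ∑ i, (y i - x i) * (ρ * Γ i).trace.re + ybar := by
    simp only [Matrix.mul_add, Matrix.mul_sum, Matrix.mul_smul, Matrix.trace_add,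
      Matrix.trace_sum, Matrix.trace_smul, hρ.1.2, Complex.add_re, Complex.re_sum, Complex.smul_re,
      smul_eq_mul, Complex.one_re, mul_one]
  have e₂ : (σ * z • (1 : Matrix (A × B) (A × B) ℂ)).trace.re = z := by
    simp [hσ.2]
  have e₃ : ∑ i, (y i - x i) * (ρ * Γ i).trace.re ≤ ∑ i, (y i * γUB i - x i * γLB i) := by
    refine Finset.sum_le_sum fun i _ => ?_
    have := mul_le_mul_of_nonneg_left (hρ.2 i).2 (hY.y_nonneg i)
    have := mul_le_mul_of_nonneg_left (hρ.2 i).1 (hY.x_nonneg i)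
    linarith
  rw [e, dualObjective]
  rw [h₃] at h₄
  linarith

/-- The maximal root fidelity over the constraint set bounds the min-entropy from below. -/
theorem le_keyMinEntropy [DecidableEq J] {E : Type*} [Fintype E] [DecidableEq E]
    (hZ : IsProjectiveMeasurement Z) {M : ℝ}
    (hM : IsGreatest {f | ∃ ρ ∈ constraintSet Γ γLB γUB, ∃ σ, IsDensity σ ∧
      f = √(fidelity ρ (pinch Z σ))} M) {ρ : Matrix (A × B) (A × B) ℂ}
    (hρ : ρ ∈ constraintSet Γ γLB γUB) {ψ : (A × B) × E → ℂ} (hψ : IsPurification ψ ρ) :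
    -2 * Real.logb 2 M ≤ keyMinEntropy Z ψ := by
  obtain ⟨-, m, hm, ⟨⟨σ, hσ, rfl⟩, -⟩, e⟩ := keyMinEntropy_eq hZ hρ.1 hψ
  have hle := Real.sqrt_le_iff.mp (hM.2 ⟨ρ, hρ, σ, hσ, rfl⟩)
  have := Real.logb_le_logb_of_le one_lt_two hm hle.2
  rw [Real.logb_pow] at this
  push_cast at this
  linarith

/-- The min-entropy attains the bound by the maximal root fidelity. -/
theorem exists_keyMinEntropy_eq [DecidableEq J] (E : Type*) [Fintype E] [DecidableEq E]
    (hZ : IsProjectiveMeasurement Z) (hcard : Fintype.card (A × B) ≤ Fintype.card E) {M : ℝ}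
    (hM0 : 0 < M)
    (hM : IsGreatest {f | ∃ ρ ∈ constraintSet Γ γLB γUB, ∃ σ, IsDensity σ ∧
      f = √(fidelity ρ (pinch Z σ))} M) :
    -2 * Real.logb 2 M ∈ keyMinEntropyValues E Z (constraintSet Γ γLB γUB) := by
  obtain ⟨ρ, hρ, σ, hσ, hMe⟩ := hM.1
  obtain ⟨ψ, hψ⟩ := exists_purification hcard hρ.1.1
  refine ⟨ρ, hρ, ψ, hψ, le_antisymm (le_keyMinEntropy hZ hM hρ hψ) ?_⟩
  -- For the maximising `ρ`, `M ^ 2` is one of the fidelities over which `m` is maximal.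
  obtain ⟨-, m, hm, hgr, e⟩ := keyMinEntropy_eq hZ hρ.1 hψ
  have hle : M ^ 2 ≤ m := by
    rw [hMe, Real.sq_sqrt (fidelity_nonneg _ _)]
    exact hgr.2 ⟨σ, hσ, rfl⟩
  have := Real.logb_le_logb_of_le one_lt_two (by positivity) hle
  rw [Real.logb_pow] at this
  push_cast at this
  linarith

lemma keyRate_mono (n N : ℕ) (leak εPA εcor : ℝ) : Monotone (keyRate n N leak εPA εcor) := by
  intro h h' hh
  unfold keyRate
  gcongr

end Optimization

end QKD

theorem mainTheorem3 {A B J ι : Type*} [Fintype A] [DecidableEq A] [Fintype B] [DecidableEq B]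
    [Fintype J] [DecidableEq J] [Fintype ι]
    (Z : J → Matrix A A ℂ) (hZ : QKD.IsProjectiveMeasurement Z)
    (Γ : ι → Matrix (A × B) (A × B) ℂ) (hΓ : ∀ i, (Γ i).IsHermitian)
    (γLB γUB : ι → ℝ) (hC : (QKD.constraintSet Γ γLB γUB).Nonempty) :
    -- the min-entropy of a single state, for every purification held by Eve
    (∀ (E : Type*) [Fintype E] [DecidableEq E] (ρ : Matrix (A × B) (A × B) ℂ)
        (ψ : (A × B) × E → ℂ), QKD.IsDensity ρ → QKD.IsPurification ψ ρ →
        IsGreatest (QKD.minEntropyWitnesses (QKD.keyEveState Z ψ)) (QKD.keyMinEntropy Z ψ) ∧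
        ∃ m : ℝ,
          IsGreatest {f | ∃ σ, QKD.IsDensity σ ∧ f = QKD.fidelity ρ (QKD.pinch Z σ)} m ∧
          QKD.keyMinEntropy Z ψ = -Real.logb 2 m) ∧
    -- `g` is the minimum of the min-entropy over the constraint set
    ∃ g : ℝ,
      (∀ (E : Type*) [Fintype E] [DecidableEq E],
        Fintype.card (A × B) ≤ Fintype.card E →
        IsLeast (QKD.keyMinEntropyValues E Z (QKD.constraintSet Γ γLB γUB)) g) ∧
      -- `g` through the maximal fidelity
      (∃ M : ℝ,
        IsGreatest {f | ∃ ρ ∈ QKD.constraintSet Γ γLB γUB, ∃ σ, QKD.IsDensity σ ∧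
          f = √(QKD.fidelity ρ (QKD.pinch Z σ))} M ∧
        g = -2 * Real.logb 2 M ∧ (2 : ℝ) ^ (-g / 2) = M) ∧
      -- the primal program has optimal value `2^{-g/2}`
      IsGreatest {f | ∃ ρ σ X₁₁ X₁₂ X₂₂, QKD.PrimalFeasible Z Γ γLB γUB ρ σ X₁₁ X₁₂ X₂₂ ∧
        f = QKD.primalObjective X₁₂} ((2 : ℝ) ^ (-g / 2)) ∧
      -- every feasible point of the dual program gives reliable bounds
      ∀ (z ybar : ℝ) (x y : ι → ℝ) (Y₁₁ Y₂₂ : Matrix (A × B) (A × B) ℂ),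
        QKD.DualFeasible Z Γ z ybar x y Y₁₁ Y₂₂ →
        (2 : ℝ) ^ (-g / 2) ≤ QKD.dualObjective γLB γUB z ybar x y ∧
        -2 * Real.logb 2 (QKD.dualObjective γLB γUB z ybar x y) ≤ g ∧
        ∀ (E : Type*) [Fintype E] [DecidableEq E], ∀ ρ ∈ QKD.constraintSet Γ γLB γUB,
          ∀ ψ : (A × B) × E → ℂ, QKD.IsPurification ψ ρ →
          -2 * Real.logb 2 (QKD.dualObjective γLB γUB z ybar x y) ≤ QKD.keyMinEntropy Z ψ ∧
          ∀ (n N : ℕ) (leak εPA εcor : ℝ), 0 < n → n ≤ N → 0 < εPA → 0 < εcor →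
            QKD.keyRate n N leak εPA εcor
                (-2 * Real.logb 2 (QKD.dualObjective γLB γUB z ybar x y)) ≤
              QKD.keyRate n N leak εPA εcor (QKD.keyMinEntropy Z ψ) := by

  obtain ⟨M, hM⟩ := QKD.exists_isGreatest_rootFidelity hZ hC
  -- Positivity comes from the single-state formula for any feasible state, with a copy of `AB` as
  -- Eve's system; it makes the logarithms of `M` and of all dual values genuine.
  have hM0 : 0 < M := by
    obtain ⟨ρ, hρ⟩ := hC
    obtain ⟨ψ, hψ⟩ := QKD.exists_purification (E := A × B) le_rfl hρ.1.1
    obtain ⟨-, m, hm, ⟨⟨σ, hσ, rfl⟩, -⟩, -⟩ := QKD.keyMinEntropy_eq hZ hρ.1 hψ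
    exact (Real.sqrt_pos.mpr hm).trans_le (hM.2 ⟨ρ, hρ, σ, hσ, rfl⟩)
  have hpow : (2 : ℝ) ^ (-(-2 * Real.logb 2 M) / 2) = M := by
    rw [show -(-2 * Real.logb 2 M) / 2 = Real.logb 2 M by ring]
    exact Real.rpow_logb two_pos (by norm_num) hM0
  refine ⟨fun E _ _ ρ ψ hρ hψ => ?_, -2 * Real.logb 2 M, fun E _ _ hcard => ⟨?_, ?_⟩,
    ⟨M, hM, rfl, hpow⟩, hpow.symm ▸ QKD.isGreatest_primal hZ hM,
    fun z ybar x y Y₁₁ Y₂₂ hY => ?_⟩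
  · obtain ⟨hG, m, -, hm, e⟩ := QKD.keyMinEntropy_eq hZ hρ hψ
    exact ⟨hG, m, hm, e⟩
  · exact QKD.exists_keyMinEntropy_eq E hZ hcard hM0 hM
  · rintro _ ⟨ρ, hρ, ψ, hψ, rfl⟩
    exact QKD.le_keyMinEntropy hZ hM hρ hψ
  · have hle : M ≤ QKD.dualObjective γLB γUB z ybar x y := by
      obtain ⟨ρ, hρ, σ, hσ, rfl⟩ := hM.1
      exact QKD.rootFidelity_le_dualObjective hZ hY hρ hσ
    have hlog : -2 * Real.logb 2 (QKD.dualObjective γLB γUB z ybar x y) ≤ -2 * Real.logb 2 M := by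
      have := Real.logb_le_logb_of_le one_lt_two hM0 hle
      linarith
    refine ⟨hpow.trans_le hle, hlog, fun E _ _ ρ hρ ψ hψ => ?_⟩
    have hH := hlog.trans (QKD.le_keyMinEntropy hZ hM hρ hψ)
    exact ⟨hH, fun n N leak εPA εcor _ _ _ _ => QKD.keyRate_mono n N leak εPA εcor hH⟩
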